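/- Let $M,N\ge 0$ and let $\rho$ be a density operator of an $M\times N$-mode continuous-variable system, that is, on $\mathcal H_A\otimes\mathcal H_B$ with $\mathcal H_A=L^2(\mathbb R^M)$ and $\mathcal H_B=L^2(\mathbb R^N)$. Let $X_k$ (multiplication by $x_k$) and $P_k=-i\,\partial/\partial x_k$ be the quadratures, so that $[X_k,P_l]=i\delta_{kl}$, and let $(O_i)$ be the family of the $2M+2N$ local observables $X_{A_k}\otimes 1$, $P_{A_k}\otimes 1$ $(1\le k\le M)$ and $1\otimes X_{B_l}$, $1\otimes P_{B_l}$ $(1\le l\le N)$. Assume that each $O_i$ has a finite second moment in $\rho$, and let $\gamma_{AB}^{CV}$ be the real symmetric matrix with entries $$\gamma_{ij}=\tfrac12\big(\langle O_iO_j\rangle_\rho+\langle O_jO_i\rangle_\rho\big)-\langle O_i\rangle_\rho\langle O_j\rangle_\rho .$$ Call $\rho$ nonsteerable from Alice to Bob if it has a local hidden state model: there are a random hidden variable $\lambda$ with a probability law $P$, density operators $\rho_\lambda$ on $\mathcal H_B$, and for each POVM $A$ of Alice (with finitely many outcomes) conditional probabilities $P(a\,|\,A,\lambda)$, such that $$\mathrm{Tr}\big[\rho\,(A(a)\otimes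 B(b))\big]=\int P(a\,|\,A,\lambda)\,\mathrm{Tr}\big[\rho_\lambda B(b)\big]\,dP(\lambda)$$ for all such POVMs $A$ of Alice and $B$ of Bob and all outcomes $a,b$; otherwise $\rho$ is steerable from Alice to Bob. If $\rho$ is nonsteerable from Alice to Bob, then $$\gamma_{AB}^{CV}\ \ge\ \mathbf 0_A\oplus i\,\Omega_B,\qquad \Omega_B=\bigoplus_{l=1}^N\frac12\begin{pmatrix}0&1\\-1&0\end{pmatrix},$$ in the order of positive semidefinite Hermitian matrices. Consequently, if this inequality is violated, then $\rho$ is steerable from Alice to Bob. -/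

import Mathlib

open scoped TensorProduct SchwartzMap LineDeriv

noncomputable section

namespace CVSteering

/-! ### Density operators, traces and the Hilbert space tensor product -/

section Hilbert

variable (H : Type*) [NormedAddCommGroup H] [InnerProductSpace ℂ H] [CompleteSpace H]

/-- The index set of a fixed Hilbert basis of `H`. -/
def basisIndex : Set H := (exists_hilbertBasis ℂ H).choose

/-- A fixed Hilbert basis of `H`. -/
def stdBasis : HilbertBasis (basisIndex H) ℂ H := (exists_hilbertBasis ℂ H).choose_spec.choose

variable {H}

/-- The trace `∑ i, ⟨e i, T (e i)⟩` of a (trace class) operator. -/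
def opTrace (T : H →L[ℂ] H) : ℂ :=
  ∑' i, inner ℂ (stdBasis H i) (T (stdBasis H i))

variable (H)

/-- A density operator: a positive operator of trace one. As `1 ≠ 0`, the trace condition contains
the convergence of the sum that defines the trace. -/
structure DensityOperator where
  op : H →L[ℂ] H
  isPositive : op.IsPositive
  trace_eq_one : opTrace op = 1

/-- A POVM with `m` outcomes: positive operators that add up to the identity. -/
structure POVM (m : ℕ) where
  effect : Fin m → H →L[ℂ] H
  isPositive : ∀ a, (effect a).IsPositive
  sum_eq_one : ∑ a, effect a = 1

variable {H}

/-- The value of a partially defined operator, extended by `0` outside the domain. -/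
def act (T : H →ₗ.[ℂ] H) (x : H) : H :=
  open Classical in if h : x ∈ T.domain then T ⟨x, h⟩ else 0

/-- The observable `T` has a finite second moment in the state `ρ`:
`T √ρ` is everywhere defined and Hilbert–Schmidt. -/
def FiniteSecondMoment (ρ : DensityOperator H) (T : H →ₗ.[ℂ] H) : Prop :=
  (∀ x, CFC.sqrt ρ.op x ∈ T.domain) ∧
    Summable fun i => ‖act T (CFC.sqrt ρ.op (stdBasis H i))‖ ^ 2

/-- The expectation value `⟨T⟩ = Tr (√ρ T √ρ)`. -/
def mean (ρ : DensityOperator H) (T : H →ₗ.[ℂ] H) : ℂ :=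
  ∑' i, inner ℂ (CFC.sqrt ρ.op (stdBasis H i)) (act T (CFC.sqrt ρ.op (stdBasis H i)))

/-- The moment `⟨S T⟩ = Tr ((S √ρ)* (T √ρ))` of two symmetric operators. -/
def moment (ρ : DensityOperator H) (S T : H →ₗ.[ℂ] H) : ℂ :=
  ∑' i, inner ℂ (act S (CFC.sqrt ρ.op (stdBasis H i))) (act T (CFC.sqrt ρ.op (stdBasis H i)))

/-- The covariance matrix
`γ i j = (⟨O i O j⟩ + ⟨O j O i⟩) / 2 - ⟨O i⟩ ⟨O j⟩` of a family of observables.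
Its entries are real numbers. -/
def covarianceMatrix {ι : Type*} (ρ : DensityOperator H) (O : ι → H →ₗ.[ℂ] H) : Matrix ι ι ℝ :=
  Matrix.of fun i j =>
    ((moment ρ (O i) (O j) + moment ρ (O j) (O i)) / 2 - mean ρ (O i) * mean ρ (O j)).re

/-- The partially defined operator with domain the range of the injective map `j`,
sending `j v` to `T v`. -/
def pmapOn {V K : Type*} [AddCommGroup V] [Module ℂ V] [AddCommGroup K] [Module ℂ K]
    (j : V →ₗ[ℂ] K) (hj : Function.Injective j) (T : V →ₗ[ℂ] K) : K →ₗ.[ℂ] K where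
  domain := LinearMap.range j
  toFun := T ∘ₗ (LinearEquiv.ofInjective j hj).symm.toLinearMap

end Hilbert

section Tensor

variable (H K : Type*) [NormedAddCommGroup H] [InnerProductSpace ℂ H]
  [NormedAddCommGroup K] [InnerProductSpace ℂ K]

/-- The Hilbert space tensor product: the completion of the algebraic one. -/
abbrev HilbertTensor : Type _ := UniformSpace.Completion (H ⊗[ℂ] K)

variable {H K}

/-- The bounded operator `E ⊗ F` on the Hilbert space tensor product. -/
def tensorOp (E : H →L[ℂ] H) (F : K →L[ℂ] K) : HilbertTensor H K →L[ℂ] HilbertTensor H K :=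
  (TensorProduct.mapL E F).completion

/-- The inclusion of an algebraic tensor product of subspaces. -/
def tensorIncl (D : Submodule ℂ H) (D' : Submodule ℂ K) : D ⊗[ℂ] D' →ₗ[ℂ] HilbertTensor H K :=
  UniformSpace.Completion.toComplₗᵢ.toLinearMap ∘ₗ TensorProduct.map D.subtype D'.subtype

theorem tensorIncl_injective (D : Submodule ℂ H) (D' : Submodule ℂ K) :
    Function.Injective (tensorIncl D D') :=
  (UniformSpace.Completion.toComplₗᵢ (𝕜 := ℂ) (E := H ⊗[ℂ] K)).injective.comp
    (TensorProduct.map_injective_of_flat_flat _ _ D.injective_subtype D'.injective_subtype)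

/-- The tensor product of two partially defined operators:
the closure of `S ⊗ T` on the algebraic tensor product of the domains. -/
def tensorPMap (S : H →ₗ.[ℂ] H) (T : K →ₗ.[ℂ] K) :
    HilbertTensor H K →ₗ.[ℂ] HilbertTensor H K :=
  (pmapOn (tensorIncl S.domain T.domain) (tensorIncl_injective _ _)
    (UniformSpace.Completion.toComplₗᵢ.toLinearMap ∘ₗ TensorProduct.map S.toFun T.toFun)).closure

/-- The identity, as an everywhere defined operator. -/
def idPMap (H : Type*) [NormedAddCommGroup H] [InnerProductSpace ℂ H] : H →ₗ.[ℂ] H :=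
  (LinearMap.id : H →ₗ[ℂ] H).toPMap ⊤

end Tensor

/-! ### Local hidden state models -/

section Steering

variable {H K : Type*} [NormedAddCommGroup H] [InnerProductSpace ℂ H] [CompleteSpace H]
  [NormedAddCommGroup K] [InnerProductSpace ℂ K] [CompleteSpace K]

/-- A bipartite state is nonsteerable from Alice (first factor) to Bob (second factor) if it has
a local hidden state model: a hidden variable `l` with law `P`, local states `σ l` of Bob, and for
each measurement of Alice conditional probabilities `p A a l = P(a | A, l)` such that
`Tr [ρ (A a ⊗ B b)] = ∫ P(a | A, l) Tr [σ l (B b)] dP(l)`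
for all measurements `A`, `B` and outcomes `a`, `b`.
The hidden variable may be continuous. Measurements have finitely many outcomes, so a model for
all measurements, with whatever outcomes, is in particular one in the present sense. -/
def NonsteerableAtoB (ρ : DensityOperator (HilbertTensor H K)) : Prop :=
  ∃ (L : Type) (_ : MeasurableSpace L) (P : MeasureTheory.Measure L)
    (σ : L → DensityOperator K) (p : {m : ℕ} → POVM H m → Fin m → L → ℝ),
    MeasureTheory.IsProbabilityMeasure P ∧
    (∀ x y : K, Measurable fun l => inner ℂ x ((σ l).op y)) ∧
    (∀ (m : ℕ) (A : POVM H m) (a : Fin m), Measurable (p A a) ∧ ∀ l, 0 ≤ p A a l) ∧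
    (∀ (m : ℕ) (A : POVM H m) (l : L), ∑ a, p A a l = 1) ∧
    ∀ (m : ℕ) (A : POVM H m) (n : ℕ) (B : POVM K n) (a : Fin m) (b : Fin n),
      opTrace (ρ.op ∘L tensorOp (A.effect a) (B.effect b)) =
        ∫ l, (p A a l : ℂ) * opTrace ((σ l).op ∘L B.effect b) ∂P

/-- A state is steerable from Alice to Bob if it has no local hidden state model. -/
def SteerableAtoB (ρ : DensityOperator (HilbertTensor H K)) : Prop := ¬ NonsteerableAtoB ρ

end Steering

/-! ### Continuous variable modes -/

/-- The configuration space of `n` modes. -/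
abbrev Config (n : ℕ) : Type := EuclideanSpace ℝ (Fin n)

/-- The Hilbert space `L²(ℝⁿ)` of `n` modes. -/
abbrev ModeSpace (n : ℕ) : Type :=
  MeasureTheory.Lp ℂ 2 (MeasureTheory.volume : MeasureTheory.Measure (Config n))

/-- Multiplication by the `k`-th coordinate on Schwartz functions. -/
def positionOp {n : ℕ} (k : Fin n) : 𝓢(Config n, ℂ) →L[ℂ] 𝓢(Config n, ℂ) :=
  SchwartzMap.smulLeftCLM ℂ fun x : Config n => ((x k : ℝ) : ℂ)

/-- The operator `-i ∂ₖ` on Schwartz functions. -/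
def momentumOp {n : ℕ} (k : Fin n) : 𝓢(Config n, ℂ) →L[ℂ] 𝓢(Config n, ℂ) :=
  (-Complex.I) • LineDeriv.lineDerivOpCLM ℂ 𝓢(Config n, ℂ) (EuclideanSpace.single k (1 : ℝ))

theorem positionOp_apply {n : ℕ} (k : Fin n) (f : 𝓢(Config n, ℂ)) (x : Config n) :
    positionOp k f x = (x k : ℂ) * f x := by
  have h : Function.HasTemperateGrowth fun x : Config n => ((x k : ℝ) : ℂ) :=
    (Complex.ofRealCLM ∘L EuclideanSpace.proj (𝕜 := ℝ) k).hasTemperateGrowth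
  simp [positionOp, SchwartzMap.smulLeftCLM_apply_apply h]

theorem momentumOp_apply {n : ℕ} (k : Fin n) (f : 𝓢(Config n, ℂ)) (x : Config n) :
    momentumOp k f x = -Complex.I * lineDeriv ℝ f x (EuclideanSpace.single k 1) := by
  simp [momentumOp, SchwartzMap.lineDerivOp_apply]

theorem schwartz_toLp_injective (n : ℕ) :
    Function.Injective (SchwartzMap.toLpCLM ℂ ℂ 2
      (MeasureTheory.volume : MeasureTheory.Measure (Config n))).toLinearMap :=
  SchwartzMap.injective_toLp 2 (MeasureTheory.volume : MeasureTheory.Measure (Config n))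

/-- The quadratures of `n` modes on `L²(ℝⁿ)`: the index `(0, k)` stands for `Xₖ` and `(1, k)`
for `Pₖ`, the closures of `xₖ` and `-i ∂ₖ` on Schwartz functions, so that `[Xₖ, Pₖ] = i`. -/
def quadrature {n : ℕ} (j : Fin 2 × Fin n) : ModeSpace n →ₗ.[ℂ] ModeSpace n :=
  (pmapOn (SchwartzMap.toLpCLM ℂ ℂ 2 MeasureTheory.volume).toLinearMap (schwartz_toLp_injective n)
    ((SchwartzMap.toLpCLM ℂ ℂ 2 MeasureTheory.volume).toLinearMap ∘ₗ
      ((![positionOp j.2, momentumOp j.2] : Fin 2 → _) j.1).toLinearMap)).closure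

/-- The Hilbert space of `M × N` modes. -/
abbrev BipartiteSpace (M N : ℕ) : Type := HilbertTensor (ModeSpace M) (ModeSpace N)

/-- All local quadratures of an `M × N`-mode system:
`Xₖ ⊗ 1`, `Pₖ ⊗ 1` for Alice and `1 ⊗ Xₗ`, `1 ⊗ Pₗ` for Bob. -/
def localQuadrature (M N : ℕ) :
    (Fin 2 × Fin M) ⊕ (Fin 2 × Fin N) → BipartiteSpace M N →ₗ.[ℂ] BipartiteSpace M N :=
  Sum.elim (fun j => tensorPMap (quadrature j) (idPMap (ModeSpace N)))
    (fun j => tensorPMap (idPMap (ModeSpace M)) (quadrature j))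

/-- The covariance matrix of an `M × N`-mode state. -/
def cvCovarianceMatrix {M N : ℕ} (ρ : DensityOperator (BipartiteSpace M N)) :
    Matrix ((Fin 2 × Fin M) ⊕ (Fin 2 × Fin N)) ((Fin 2 × Fin M) ⊕ (Fin 2 × Fin N)) ℝ :=
  covarianceMatrix ρ (localQuadrature M N)

/-- The block symplectic form: the direct sum over the `N` modes of `½ (0 1; -1 0)`. -/
def symplecticForm (N : ℕ) : Matrix (Fin 2 × Fin N) (Fin 2 × Fin N) ℂ :=
  Matrix.blockDiagonal fun _ => !![0, 1 / 2; -1 / 2, 0]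

open scoped ComplexOrder in
/-- The inequality `γ ≥ 0_A ⊕ i Ω_B` in the positive semidefinite order. -/
def SatisfiesCVC {M N : ℕ} (ρ : DensityOperator (BipartiteSpace M N)) : Prop :=
  ((cvCovarianceMatrix ρ).map Complex.ofReal -
    Matrix.fromBlocks 0 0 0 (Complex.I • symplecticForm N)).PosSemidef

end CVSteering

end

set_option linter.unusedSectionVars false

/-! A local hidden state model lets Alice's noncommuting observables act on Bob's side like
classical random variables. At a fixed hidden value `l`, a bounded observable `T` of Alice gets the
value `τ l`, the conditional mean of its outcome; by Jensen the average of `τ ^ 2` is at most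
`⟨T²⟩`, up to an arbitrarily small error. Bob's state `σ l` does not depend on what Alice measures,
so two observables `T₁`, `T₂` receive values `τ₁`, `τ₂` at the same `l`. For bounded `R₁`, `R₂` of
Bob put `G = (R₁ + τ₁) + i (R₂ + τ₂)`. Positivity of `G* G` in `σ l`, averaged over `l`, gives `⟨(T₁
+ R₁)²⟩ + ⟨(T₂ + R₂)²⟩ + ⟨i [R₁, R₂]⟩ ≥ 0`, which is `NonsteerableAtoB.bounded_inequality`. Only
Bob's commutator appears, whence the zero block for Alice.

Applied to centred linear combinations of quadratures with real coefficients `v` and `w`, the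
inequality becomes `v·γv + w·γw ≥ ω(v_B, w_B)` with the standard symplectic form `ω`. This is the
asserted Hermitian inequality on the vector `w + i v`.

Two gaps have to be bridged. Measurements have finitely many outcomes, so a spectral measure is not
at hand; `exists_povm` uses instead the Bernstein polynomials of an effect, a POVM with the exact
first moment and almost the right second moment. The quadratures are unbounded; they are
approximated by the bounded self-adjoint operators `(U s - U (-s)) / (2 i s)`, where `U` is the Weyl
group of the linear combination. On the vectors `√ρ eᵢ` these converge and never exceed their limit
in norm (`IsWeakGenerator.tendsto_centralDiff`, `IsWeakGenerator.norm_centralDiff_le`), so finite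
second moments permit dominated convergence (`NonsteerableAtoB.limit_inequality`). The limit of the
commutator comes from the Weyl relation (`IsWeakGenerator.inner_sub_inner`). All this needs only
weak derivatives against a dense set of vectors built from Schwartz functions; self-adjointness of
the closed quadratures plays no role. -/

noncomputable section

namespace CVSteering

/-! ### Expectation values as sums over the vectors `√ρ eᵢ`. -/

section Expectation

variable {H : Type*} [NormedAddCommGroup H] [InnerProductSpace ℂ H] [CompleteSpace H]

/-- The vectors `√ρ (e i)`; the state is the sum of the corresponding rank one operators. -/
def rootVec (ρ : DensityOperator H) (i : basisIndex H) : H := CFC.sqrt ρ.op (stdBasis H i)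

theorem sqrt_comp_sqrt (ρ : DensityOperator H) (x : H) :
    CFC.sqrt ρ.op (CFC.sqrt ρ.op x) = ρ.op x := by
  have h := CFC.sqrt_mul_sqrt_self ρ.op
    ((ContinuousLinearMap.nonneg_iff_isPositive _).2 ρ.isPositive)
  exact congrArg (fun T : H →L[ℂ] H => T x) h

theorem inner_sqrt_left (ρ : DensityOperator H) (x y : H) :
    inner ℂ (CFC.sqrt ρ.op x) y = inner ℂ x (CFC.sqrt ρ.op y) :=
  ((ContinuousLinearMap.nonneg_iff_isPositive _).1 (CFC.sqrt_nonneg ρ.op)).inner_left_eq_inner_right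
    x y

theorem inner_op_basis (ρ : DensityOperator H) (i : basisIndex H) :
    inner ℂ (stdBasis H i) (ρ.op (stdBasis H i)) = ((‖rootVec ρ i‖ ^ 2 : ℝ) : ℂ) := by
  rw [← sqrt_comp_sqrt, ← inner_sqrt_left, ← rootVec, inner_self_eq_norm_sq_to_K]
  push_cast; rfl

/-- A divergent `tsum` has the default value `0`, so trace one forces convergence. All later
dominated convergence arguments rest on this. -/
theorem hasSum_norm_sq_rootVec (ρ : DensityOperator H) :
    HasSum (fun i => ‖rootVec ρ i‖ ^ 2) 1 := by
  have h := ρ.trace_eq_one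
  unfold opTrace at h
  simp_rw [inner_op_basis] at h
  have hs : Summable fun i => ((‖rootVec ρ i‖ ^ 2 : ℝ) : ℂ) := by
    by_contra hn
    rw [tsum_eq_zero_of_not_summable hn] at h
    exact zero_ne_one h
  have h2 := hs.hasSum
  rw [h] at h2
  rw [← Complex.ofReal_one] at h2
  exact Complex.hasSum_ofReal.1 h2

theorem summable_norm_sq_rootVec (ρ : DensityOperator H) :
    Summable fun i => ‖rootVec ρ i‖ ^ 2 := (hasSum_norm_sq_rootVec ρ).summable

/-- The expectation value of a bounded operator, as a sum over the vectors `√ρ (e i)`. -/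
def expect (ρ : DensityOperator H) (T : H →L[ℂ] H) : ℂ :=
  ∑' i, inner ℂ (rootVec ρ i) (T (rootVec ρ i))

theorem norm_inner_apply_le (T : H →L[ℂ] H) (x : H) : ‖inner ℂ x (T x)‖ ≤ ‖T‖ * ‖x‖ ^ 2 :=
  calc ‖inner ℂ x (T x)‖ ≤ ‖x‖ * ‖T x‖ := norm_inner_le_norm _ _
    _ ≤ ‖x‖ * (‖T‖ * ‖x‖) := by gcongr; exact T.le_opNorm x
    _ = _ := by ring

theorem summable_expect (ρ : DensityOperator H) (T : H →L[ℂ] H) :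
    Summable fun i => inner ℂ (rootVec ρ i) (T (rootVec ρ i)) :=
  ((summable_norm_sq_rootVec ρ).mul_left ‖T‖).of_norm_bounded fun _ => norm_inner_apply_le _ _

theorem expect_add (ρ : DensityOperator H) (S T : H →L[ℂ] H) :
    expect ρ (S + T) = expect ρ S + expect ρ T := by
  simp only [expect, add_apply, inner_add_right]
  exact (summable_expect ρ S).tsum_add (summable_expect ρ T)

theorem expect_smul (ρ : DensityOperator H) (c : ℂ) (T : H →L[ℂ] H) :
    expect ρ (c • T) = c * expect ρ T := by
  simp only [expect, smul_apply, inner_smul_right]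
  exact tsum_mul_left

/-- The expectation value as a linear functional. -/
def expectₗ (ρ : DensityOperator H) : (H →L[ℂ] H) →ₗ[ℂ] ℂ where
  toFun := expect ρ
  map_add' := expect_add ρ
  map_smul' := expect_smul ρ

theorem expect_sub (ρ : DensityOperator H) (S T : H →L[ℂ] H) :
    expect ρ (S - T) = expect ρ S - expect ρ T := map_sub (expectₗ ρ) S T

theorem expect_sum {ι : Type*} (ρ : DensityOperator H) (s : Finset ι) (T : ι → H →L[ℂ] H) :
    expect ρ (∑ i ∈ s, T i) = ∑ i ∈ s, expect ρ (T i) := map_sum (expectₗ ρ) T s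

theorem expect_one (ρ : DensityOperator H) : expect ρ 1 = 1 := by
  have h := (Complex.hasSum_ofReal.2 (hasSum_norm_sq_rootVec ρ)).tsum_eq
  rw [Complex.ofReal_one] at h
  rw [← h]
  refine tsum_congr fun i => ?_
  simp [inner_self_eq_norm_sq_to_K]

theorem norm_expect_le (ρ : DensityOperator H) (T : H →L[ℂ] H) : ‖expect ρ T‖ ≤ ‖T‖ := by
  have h := (hasSum_norm_sq_rootVec ρ).mul_left ‖T‖
  rw [mul_one] at h
  exact tsum_of_norm_bounded h fun _ => norm_inner_apply_le _ _

theorem expect_adjoint_mul_self (ρ : DensityOperator H) (G : H →L[ℂ] H) :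
    expect ρ (star G * G) = ((∑' i, ‖G (rootVec ρ i)‖ ^ 2 : ℝ) : ℂ) := by
  rw [Complex.ofReal_tsum]
  refine tsum_congr fun i => ?_
  rw [ContinuousLinearMap.star_eq_adjoint, mul_apply_eq_comp,
    ContinuousLinearMap.adjoint_inner_right, inner_self_eq_norm_sq_to_K]
  push_cast; rfl

theorem hasSum_norm_sq_inner {ι : Type*} (b : HilbertBasis ι ℂ H) (x : H) :
    HasSum (fun j => ‖inner ℂ x (b j)‖ ^ 2) (‖x‖ ^ 2) := by
  have h := b.hasSum_inner_mul_inner x x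
  have h1 : inner ℂ x x = ((‖x‖ ^ 2 : ℝ) : ℂ) := by
    rw [inner_self_eq_norm_sq_to_K]; push_cast; rfl
  have h2 : ∀ j, inner ℂ x (b j) * inner ℂ (b j) x = ((‖inner ℂ x (b j)‖ ^ 2 : ℝ) : ℂ) :=
    fun j => by
      rw [← inner_conj_symm (b j) x, Complex.mul_conj, Complex.normSq_eq_norm_sq]
  rw [h1] at h
  simp_rw [h2] at h
  exact Complex.hasSum_ofReal.1 h

/-- Parseval in the second index. It supplies the square summable matrix elements for the exchange
of sums in the cyclicity of the trace. -/
theorem summable_norm_sq_inner {ι κ : Type*} (b : HilbertBasis ι ℂ H) (v : κ → H)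
    (hv : Summable fun i => ‖v i‖ ^ 2) :
    Summable fun p : κ × ι => ‖inner ℂ (v p.1) (b p.2)‖ ^ 2 := by
  rw [summable_prod_of_nonneg (fun p => sq_nonneg ‖inner ℂ (v p.1) (b p.2)‖)]
  refine ⟨fun i => (hasSum_norm_sq_inner b (v i)).summable, ?_⟩
  simp_rw [(hasSum_norm_sq_inner b (v _)).tsum_eq]
  exact hv

/-- Cyclicity of the trace, `Tr (ρ T) = Tr (√ρ T √ρ)`. -/
theorem opTrace_comp_eq_expect (ρ : DensityOperator H) (T : H →L[ℂ] H) :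
    opTrace (ρ.op ∘L T) = expect ρ T := by
  set S := CFC.sqrt ρ.op with hSdef
  set e := stdBasis H
  have h1 := summable_norm_sq_inner e (fun i => S (e i)) (summable_norm_sq_rootVec ρ)
  have h2 := summable_norm_sq_inner e (fun i => (star T * S) (e i)) (by
    refine ((summable_norm_sq_rootVec ρ).mul_left (‖star T‖ ^ 2)).of_nonneg_of_le
      (fun _ => by positivity) fun i => ?_
    rw [← mul_pow]
    gcongr
    exact (star T).le_opNorm _)
  have h3 := (Equiv.prodComm _ _).summable_iff.2 h2
  -- Both factors are Hilbert–Schmidt matrix elements, so the product is dominated by the sum of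
  -- their squares, and the order of summation may be exchanged.
  have hs : Summable (Function.uncurry fun i j =>
      inner ℂ (S (e i)) (e j) * inner ℂ ((star T * S) (e j)) (e i)) := by
    refine (h1.add h3).of_norm_bounded fun p => ?_
    simp only [Function.uncurry_def, norm_mul, Function.comp_apply, Equiv.prodComm_apply,
      Prod.fst_swap, Prod.snd_swap]
    nlinarith [sq_nonneg (‖inner ℂ (S (e p.1)) (e p.2)‖ -
      ‖inner ℂ ((star T * S) (e p.2)) (e p.1)‖), sq_nonneg (‖inner ℂ (S (e p.1)) (e p.2)‖),
      sq_nonneg (‖inner ℂ ((star T * S) (e p.2)) (e p.1)‖)]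
  have hT : ∀ x y : H, inner ℂ ((star T * S) x) y = inner ℂ x (S (T y)) := by
    intro x y
    rw [mul_apply_eq_comp, ContinuousLinearMap.star_eq_adjoint,
      ContinuousLinearMap.adjoint_inner_left, hSdef, inner_sqrt_left]
  calc opTrace (ρ.op ∘L T)
      = ∑' i, ∑' j, inner ℂ (S (e i)) (e j) * inner ℂ ((star T * S) (e j)) (e i) := by
        refine tsum_congr fun i => ?_
        simp_rw [hT]
        rw [e.tsum_inner_mul_inner, ContinuousLinearMap.comp_apply, ← sqrt_comp_sqrt,
          ← inner_sqrt_left]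
    _ = ∑' j, ∑' i, inner ℂ (S (e i)) (e j) * inner ℂ ((star T * S) (e j)) (e i) :=
        (hs.tsum_comm).symm
    _ = expect ρ T := by
        refine tsum_congr fun j => ?_
        have : ∀ i, inner ℂ (S (e i)) (e j) * inner ℂ ((star T * S) (e j)) (e i) =
            inner ℂ ((star T * S) (e j)) (e i) * inner ℂ (e i) (S (e j)) := fun i => by
          rw [mul_comm, inner_sqrt_left]
        simp_rw [this]
        rw [e.tsum_inner_mul_inner, mul_apply_eq_comp,
          ContinuousLinearMap.star_eq_adjoint, ContinuousLinearMap.adjoint_inner_left]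
        rfl

end Expectation

/-! ### Pure tensors and the operators `E ⊗ F`. -/

section TensorOp

variable {H K : Type*} [NormedAddCommGroup H] [InnerProductSpace ℂ H]
  [NormedAddCommGroup K] [InnerProductSpace ℂ K]

/-- The pure tensor `x ⊗ y` in the Hilbert space tensor product. -/
def pureTensor (x : H) (y : K) : HilbertTensor H K := ((x ⊗ₜ[ℂ] y : H ⊗[ℂ] K) : HilbertTensor H K)

theorem inner_pureTensor (x x' : H) (y y' : K) :
    inner ℂ (pureTensor x y) (pureTensor x' y') = inner ℂ x x' * inner ℂ y y' := by
  simp [pureTensor, UniformSpace.Completion.inner_coe]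

theorem tensorOp_pureTensor (E : H →L[ℂ] H) (F : K →L[ℂ] K) (x : H) (y : K) :
    tensorOp E F (pureTensor x y) = pureTensor (E x) (F y) := by
  simp [pureTensor, tensorOp, ContinuousLinearMap.completion_apply_coe]

/-- Continuity of `(x, y) ↦ x ⊗ y` carries density from `s ×ˢ t` to all pure tensors. Dense subsets
are allowed so that one factor may be restricted to Schwartz functions. -/
theorem dense_span_pureTensor {s : Set H} {t : Set K} (hs : Dense s) (ht : Dense t) :
    Dense (Submodule.span ℂ {z : HilbertTensor H K | ∃ x ∈ s, ∃ y ∈ t, z = pureTensor x y} :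
      Set (HilbertTensor H K)) := by
  set D := Submodule.span ℂ {z : HilbertTensor H K | ∃ x ∈ s, ∃ y ∈ t, z = pureTensor x y}
  have hpure : ∀ x : H, ∀ y : K, pureTensor x y ∈ D.topologicalClosure := by
    intro x y
    have hc : Continuous fun p : H × K => (pureTensor p.1 p.2 : HilbertTensor H K) :=
      (UniformSpace.Completion.continuous_coe _).comp TensorProduct.continuous_tmul
    have hd : Dense (s ×ˢ t) := hs.prod ht
    refine (D.isClosed_topologicalClosure.preimage hc).closure_subset_iff.2 ?_ (hd (x, y))
    rintro ⟨x, y⟩ ⟨hx, hy⟩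
    exact D.le_topologicalClosure (Submodule.subset_span ⟨x, hx, y, hy, rfl⟩)
  intro z
  induction z using UniformSpace.Completion.induction_on with
  | hp => exact isClosed_closure
  | ih a =>
    change (a : HilbertTensor H K) ∈ D.topologicalClosure
    induction a using TensorProduct.induction_on with
    | zero => rw [UniformSpace.Completion.coe_zero]; exact zero_mem _
    | tmul x y => exact hpure x y
    | add a b ha hb => rw [UniformSpace.Completion.coe_add]; exact add_mem ha hb

theorem tensor_clm_ext {X : Type*} [TopologicalSpace X] [T2Space X] [AddCommGroup X] [Module ℂ X]
    {S T : HilbertTensor H K →L[ℂ] X}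
    (h : ∀ x y, S (pureTensor x y) = T (pureTensor x y)) : S = T := by
  refine ContinuousLinearMap.ext_on
    (dense_span_pureTensor (dense_univ (X := H)) (dense_univ (X := K))) ?_
  rintro _ ⟨x, -, y, -, rfl⟩
  exact h x y

theorem pureTensor_add_left (x x' : H) (y : K) :
    pureTensor (x + x') y = pureTensor x y + pureTensor x' y := by
  simp [pureTensor, TensorProduct.add_tmul, UniformSpace.Completion.coe_add]

theorem pureTensor_add_right (x : H) (y y' : K) :
    pureTensor x (y + y') = pureTensor x y + pureTensor x y' := by
  simp [pureTensor, TensorProduct.tmul_add, UniformSpace.Completion.coe_add]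

theorem pureTensor_smul_left (c : ℂ) (x : H) (y : K) :
    pureTensor (c • x) y = c • pureTensor x y := by
  rw [pureTensor, ← TensorProduct.smul_tmul', UniformSpace.Completion.coe_smul, pureTensor]

theorem pureTensor_smul_right (c : ℂ) (x : H) (y : K) :
    pureTensor x (c • y) = c • pureTensor x y := by
  rw [pureTensor, TensorProduct.tmul_smul, UniformSpace.Completion.coe_smul, pureTensor]

theorem norm_pureTensor (x : H) (y : K) : ‖pureTensor x y‖ = ‖x‖ * ‖y‖ := by
  simp [pureTensor]

/-- The map `E ↦ E ⊗ F`. -/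
def tensorOpLeft (F : K →L[ℂ] K) :
    (H →L[ℂ] H) →ₗ[ℂ] (HilbertTensor H K →L[ℂ] HilbertTensor H K) where
  toFun E := tensorOp E F
  map_add' E E' := tensor_clm_ext fun x y => by
    simp only [add_apply, tensorOp_pureTensor, pureTensor_add_left]
  map_smul' c E := tensor_clm_ext fun x y => by
    simp only [smul_apply, tensorOp_pureTensor, pureTensor_smul_left, RingHom.id_apply]

/-- The map `F ↦ E ⊗ F`. -/
def tensorOpRight (E : H →L[ℂ] H) :
    (K →L[ℂ] K) →ₗ[ℂ] (HilbertTensor H K →L[ℂ] HilbertTensor H K) where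
  toFun F := tensorOp E F
  map_add' F F' := tensor_clm_ext fun x y => by
    simp only [add_apply, tensorOp_pureTensor, pureTensor_add_right]
  map_smul' c F := tensor_clm_ext fun x y => by
    simp only [smul_apply, tensorOp_pureTensor, pureTensor_smul_right, RingHom.id_apply]

@[simp] theorem tensorOpLeft_apply (F : K →L[ℂ] K) (E : H →L[ℂ] H) :
    tensorOpLeft F E = tensorOp E F := rfl

@[simp] theorem tensorOpRight_apply (E : H →L[ℂ] H) (F : K →L[ℂ] K) :
    tensorOpRight E F = tensorOp E F := rfl

theorem tensorOp_mul (E E' : H →L[ℂ] H) (F F' : K →L[ℂ] K) :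
    tensorOp E F * tensorOp E' F' = tensorOp (E * E') (F * F') :=
  tensor_clm_ext fun x y => by simp only [mul_apply_eq_comp, tensorOp_pureTensor]

theorem tensorOp_one : tensorOp (1 : H →L[ℂ] H) (1 : K →L[ℂ] K) = 1 :=
  tensor_clm_ext fun x y => by simp only [one_apply_eq_self, tensorOp_pureTensor]

theorem star_tensorOp [CompleteSpace H] [CompleteSpace K] (E : H →L[ℂ] H) (F : K →L[ℂ] K) :
    star (tensorOp E F) = tensorOp (star E) (star F) := by
  have key : ∀ z : HilbertTensor H K, ∀ x y, inner ℂ (tensorOp E F z) (pureTensor x y) =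
      inner ℂ z (tensorOp (star E) (star F) (pureTensor x y)) := by
    intro z x y
    have hd := dense_span_pureTensor (dense_univ (X := H)) (dense_univ (X := K))
    have h : (innerSL ℂ (pureTensor x y) ∘L tensorOp E F) =
        innerSL ℂ (tensorOp (star E) (star F) (pureTensor x y)) := by
      refine tensor_clm_ext fun x' y' => ?_
      simp only [ContinuousLinearMap.comp_apply, innerSL_apply_apply, tensorOp_pureTensor,
        inner_pureTensor, ContinuousLinearMap.star_eq_adjoint,
        ContinuousLinearMap.adjoint_inner_left]
    have h2 := congrArg (fun f => (starRingEnd ℂ) (f z)) h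
    simpa only [ContinuousLinearMap.comp_apply, innerSL_apply_apply, inner_conj_symm] using h2
  refine tensor_clm_ext fun x y => ?_
  refine ext_inner_left ℂ fun z => ?_
  rw [ContinuousLinearMap.star_eq_adjoint, ContinuousLinearMap.adjoint_inner_right, key]

end TensorOp
end CVSteering

/-! ### Separability, and finite POVMs that imitate spectral measures. -/

namespace CVSteering
open MeasureTheory

/-- Distinct basis vectors are at distance `√2 > 1`, so the balls of radius `1/2` around them are
disjoint. -/
theorem _root_.HilbertBasis.countable {ι H : Type*} [NormedAddCommGroup H] [InnerProductSpace ℂ H]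
    [TopologicalSpace.SeparableSpace H] (b : HilbertBasis ι ℂ H) : Countable ι := by
  refine Pairwise.countable_of_isOpen_disjoint (s := fun i => Metric.ball (b i) (1 / 2)) ?_
    (fun i => Metric.isOpen_ball) (fun i => ⟨b i, Metric.mem_ball_self (by norm_num)⟩)
  intro i j hij
  refine Metric.ball_disjoint_ball ?_
  have h1 := b.orthonormal.1 i
  have h2 := b.orthonormal.1 j
  have h3 := norm_sub_sq (𝕜 := ℂ) (b i) (b j)
  rw [b.orthonormal.2 hij, h1, h2] at h3
  simp only [map_zero] at h3
  rw [dist_eq_norm]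
  nlinarith [norm_nonneg (b i - b j)]

instance separableSpace_modeSpace (n : ℕ) : TopologicalSpace.SeparableSpace (ModeSpace n) := by
  have : Fact ((2 : ENNReal) ≠ ⊤) := ⟨ENNReal.ofNat_ne_top⟩
  have := Lp.SecondCountableTopology (X := Config n) (E := ℂ) (μ := volume) (p := 2)
  infer_instance

section LHS

variable {H K : Type*} [NormedAddCommGroup H] [InnerProductSpace ℂ H] [CompleteSpace H]
  [NormedAddCommGroup K] [InnerProductSpace ℂ K] [CompleteSpace K]

/-- The Bernstein polynomials of an operator `0 ≤ T ≤ 1` as a POVM. -/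
def bernsteinPOVM (T : H →L[ℂ] H) (h0 : 0 ≤ T) (h1 : T ≤ 1) (n : ℕ) : POVM H (n + 1) where
  effect k := Polynomial.aeval T (bernsteinPolynomial ℂ n k)
  isPositive k := by
    rw [← ContinuousLinearMap.nonneg_iff_isPositive]
    have h1' : 0 ≤ 1 - T := sub_nonneg.2 h1
    have hpow : ∀ {S : H →L[ℂ] H}, 0 ≤ S → ∀ m : ℕ, 0 ≤ S ^ m := by
      intro S hS m
      induction m with
      | zero => rw [pow_zero]; exact (ContinuousLinearMap.nonneg_iff_isPositive _).2 ContinuousLinearMap.isPositive_one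
      | succ m ih => rw [pow_succ]; exact Commute.mul_nonneg ih hS ((Commute.refl S).pow_left m)
    -- A product of commuting positive operators is positive, which applies to powers of `T` and of
    -- `1 - T`.
    have hc : Commute (T ^ (k : ℕ)) ((1 - T) ^ (n - k)) :=
      (((Commute.one_right T).sub_right (Commute.refl T)).pow_pow _ _)
    have h := Commute.mul_nonneg (hpow h0 k) (hpow h1' (n - k)) hc
    have h2 : Polynomial.aeval T (bernsteinPolynomial ℂ n k) =
        n.choose k • (T ^ (k : ℕ) * (1 - T) ^ (n - k)) := by
      simp [bernsteinPolynomial, mul_assoc]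
    rw [h2]
    exact nsmul_nonneg h _
  sum_eq_one := by
    rw [Fin.sum_univ_eq_sum_range (fun k => Polynomial.aeval T (bernsteinPolynomial ℂ n k)),
      ← map_sum, bernsteinPolynomial.sum, map_one]

theorem sum_smul_bernsteinPOVM (T : H →L[ℂ] H) (h0 : 0 ≤ T) (h1 : T ≤ 1) (n : ℕ) :
    ∑ k : Fin (n + 1), ((k : ℕ) : ℂ) • (bernsteinPOVM T h0 h1 n).effect k = (n : ℂ) • T := by
  have h := congrArg (Polynomial.aeval T) (bernsteinPolynomial.sum_smul ℂ n)
  rw [map_sum] at h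
  simp only [map_nsmul, Polynomial.aeval_X] at h
  simp only [bernsteinPOVM, Nat.cast_smul_eq_nsmul]
  rw [Fin.sum_univ_eq_sum_range (fun k => k • Polynomial.aeval T (bernsteinPolynomial ℂ n k)), h]

theorem sum_sq_smul_bernsteinPOVM (T : H →L[ℂ] H) (h0 : 0 ≤ T) (h1 : T ≤ 1) (n : ℕ) :
    ∑ k : Fin (n + 1), ((k : ℕ) : ℂ) ^ 2 • (bernsteinPOVM T h0 h1 n).effect k =
      (n : ℂ) ^ 2 • T ^ 2 + (n : ℂ) • (T * (1 - T)) := by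
  -- Expanding the square in the Bernstein variance identity `∑ (nX - k)² bₖ = nX(1 - X)` and
  -- inserting the zeroth and first moments isolates the second moment.
  have hv : ∑ k ∈ Finset.range (n + 1), ((k : ℂ) ^ 2) • bernsteinPolynomial ℂ n k =
      (n : ℂ) ^ 2 • Polynomial.X ^ 2 + (n : ℂ) • (Polynomial.X * (1 - Polynomial.X)) := by
    have e0 := bernsteinPolynomial.sum ℂ n
    have e1 := bernsteinPolynomial.sum_smul ℂ n
    have e2 := bernsteinPolynomial.variance ℂ n
    simp only [nsmul_eq_mul] at e1 e2
    have hexp : ∀ k : ℕ, ((n : Polynomial ℂ) * Polynomial.X - (k : Polynomial ℂ)) ^ 2 *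
        bernsteinPolynomial ℂ n k = (n : Polynomial ℂ) ^ 2 * Polynomial.X ^ 2 *
          bernsteinPolynomial ℂ n k - 2 * (n : Polynomial ℂ) * Polynomial.X * ((k : Polynomial ℂ) * bernsteinPolynomial ℂ n k) +
          ((k : ℂ) ^ 2) • bernsteinPolynomial ℂ n k := fun k => by
      rw [Polynomial.smul_eq_C_mul]; simp only [map_pow, map_natCast]; ring
    simp_rw [hexp] at e2
    rw [Finset.sum_add_distrib, Finset.sum_sub_distrib, ← Finset.mul_sum, ← Finset.mul_sum, e0,
      e1] at e2
    simp only [Polynomial.smul_eq_C_mul, map_pow, map_natCast] at e2 ⊢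
    linear_combination e2
  have h := congrArg (Polynomial.aeval T) hv
  rw [map_sum] at h
  simp only [map_smul, map_add, map_mul, map_pow, map_sub, map_one, Polynomial.aeval_X] at h
  simp only [bernsteinPOVM]
  rw [Fin.sum_univ_eq_sum_range
    (fun k => (k : ℂ) ^ 2 • Polynomial.aeval T (bernsteinPolynomial ℂ n k)), h]

/-- Every bounded self-adjoint operator is affinely equivalent to an effect. -/
theorem exists_effect {T : H →L[ℂ] H} (hT : IsSelfAdjoint T) :
    ∃ (c : ℝ) (S : H →L[ℂ] H), 0 < c ∧ 0 ≤ S ∧ S ≤ 1 ∧ T = ((2 * c : ℝ) : ℂ) • S - (c : ℂ) • (1 : H →L[ℂ] H) := by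
  -- Since `-c ≤ T ≤ c`, the operator `(T + c) / 2c` is an effect; the summand `1` keeps `c`
  -- positive when `T = 0`.
  set c : ℝ := ‖T‖ + 1 with hc
  have hc0 : 0 < c := by positivity
  have hb : ∀ x : H, |(inner ℂ (T x) x).re| ≤ c * ‖x‖ ^ 2 := fun x => by
    have h1 := (Complex.abs_re_le_norm _).trans (norm_inner_apply_le T x)
    rw [← inner_conj_symm, Complex.conj_re]
    nlinarith [sq_nonneg ‖x‖]
  -- The sign `s = 1` gives `0 ≤ S`, and `s = -1` gives `0 ≤ 1 - S`, because `1 - S = (c - T) / 2c`.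
  have hpos : ∀ s : ℝ, |s| = 1 →
      (0 : H →L[ℂ] H) ≤ ((2 * c : ℝ) : ℂ)⁻¹ • ((s : ℂ) • T + (c : ℂ) • 1) := by
    intro s hs
    rw [ContinuousLinearMap.nonneg_iff_isPositive]
    have hsa : IsSelfAdjoint ((s : ℂ) • T + (c : ℂ) • (1 : H →L[ℂ] H)) :=
      (IsSelfAdjoint.smul (r := (s : ℂ)) (Complex.conj_ofReal s) hT).add
        (IsSelfAdjoint.smul (r := (c : ℂ)) (Complex.conj_ofReal c) (IsSelfAdjoint.one _))
    have hp : ((s : ℂ) • T + (c : ℂ) • (1 : H →L[ℂ] H)).IsPositive := by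
      rw [ContinuousLinearMap.isPositive_def]
      refine ⟨hsa.isSymmetric, fun x => ?_⟩
      have h1 : (inner ℂ x x : ℂ) = ((‖x‖ ^ 2 : ℝ) : ℂ) := by
        rw [inner_self_eq_norm_sq_to_K]; push_cast; rfl
      have h2 : ((s : ℂ) • T + (c : ℂ) • (1 : H →L[ℂ] H)).reApplyInnerSelf x =
          s * (inner ℂ (T x) x).re + c * ‖x‖ ^ 2 := by
        simp only [ContinuousLinearMap.reApplyInnerSelf, add_apply, smul_apply, one_apply_eq_self,
          inner_add_left, inner_smul_left, h1, Complex.conj_ofReal, RCLike.re_to_complex,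
          Complex.add_re, Complex.re_ofReal_mul, Complex.ofReal_re]
      rw [h2]
      have h3 := hb x
      have h4 : |s * (inner ℂ (T x) x).re| ≤ c * ‖x‖ ^ 2 := by rwa [abs_mul, hs, one_mul]
      linarith [(abs_le.1 h4).1]
    have h5 := hp.smul_of_nonneg (c := ((2 * c : ℝ) : ℂ)⁻¹) (by
      rw [← Complex.ofReal_inv]; exact_mod_cast (by positivity))
    exact h5
  have hcc : ((2 * c : ℝ) : ℂ) ≠ 0 := by exact_mod_cast (by positivity)
  refine ⟨c, ((2 * c : ℝ) : ℂ)⁻¹ • (T + (c : ℂ) • 1), hc0, ?_, ?_, ?_⟩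
  · simpa using hpos 1 (by simp)
  · rw [← sub_nonneg]
    convert hpos (-1) (by simp) using 1
    rw [eq_inv_smul_iff₀ hcc, smul_sub, smul_inv_smul₀ hcc]
    push_cast
    module
  · rw [smul_inv_smul₀ hcc]; abel

/-- A bounded observable is the first moment of a POVM whose second moment is arbitrarily close to
the square of the observable. -/
theorem exists_povm {T : H →L[ℂ] H} (hT : IsSelfAdjoint T) {δ : ℝ} (hδ : 0 < δ) :
    ∃ (m : ℕ) (A : POVM H m) (t : Fin m → ℝ), ∑ a, (t a : ℂ) • A.effect a = T ∧
      ‖∑ a, ((t a ^ 2 : ℝ) : ℂ) • A.effect a - T * T‖ ≤ δ := by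
  obtain ⟨c, S, hc, h0, h1, rfl⟩ := exists_effect hT
  -- The second moment of the POVM below exceeds `T²` by exactly `(4c²/n) S(1 - S)`; this `n` makes
  -- the norm of the excess at most `δ`.
  obtain ⟨n, hn⟩ := exists_nat_gt (4 * c ^ 2 * ‖S * (1 - S)‖ / δ)
  have hn0 : (0 : ℝ) < n := lt_of_le_of_lt (by positivity) hn
  have hnC : (n : ℂ) ≠ 0 := by exact_mod_cast hn0.ne'
  have s0 := (bernsteinPOVM S h0 h1 n).sum_eq_one
  have s1 := sum_smul_bernsteinPOVM S h0 h1 n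
  have s2 := sum_sq_smul_bernsteinPOVM S h0 h1 n
  -- The frequency `k/n` has first moment `S`, so the affine map `x ↦ 2c x - c` that takes `S` to
  -- `T` is applied to it.
  refine ⟨n + 1, bernsteinPOVM S h0 h1 n, fun k => 2 * c / n * (k : ℕ) - c, ?_, ?_⟩
  · have : ∀ k : Fin (n + 1), ((2 * c / n * (k : ℕ) - c : ℝ) : ℂ) •
        (bernsteinPOVM S h0 h1 n).effect k = (2 * c / n : ℂ) •
          (((k : ℕ) : ℂ) • (bernsteinPOVM S h0 h1 n).effect k) -
          (c : ℂ) • (bernsteinPOVM S h0 h1 n).effect k := fun k => by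
      push_cast; module
    simp_rw [this]
    rw [Finset.sum_sub_distrib, ← Finset.smul_sum, ← Finset.smul_sum, s0, s1, smul_smul]
    congr 2
    push_cast; field_simp
  · have : ∀ k : Fin (n + 1), (((2 * c / n * (k : ℕ) - c) ^ 2 : ℝ) : ℂ) •
        (bernsteinPOVM S h0 h1 n).effect k = ((2 * c / n) ^ 2 : ℂ) •
          (((k : ℕ) : ℂ) ^ 2 • (bernsteinPOVM S h0 h1 n).effect k) -
          (4 * c ^ 2 / n : ℂ) • (((k : ℕ) : ℂ) • (bernsteinPOVM S h0 h1 n).effect k) +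
          (c : ℂ) ^ 2 • (bernsteinPOVM S h0 h1 n).effect k := fun k => by
      push_cast; module
    simp_rw [this]
    rw [Finset.sum_add_distrib, Finset.sum_sub_distrib, ← Finset.smul_sum, ← Finset.smul_sum,
      ← Finset.smul_sum, s0, s1, s2]
    have e : ((2 * c / n) ^ 2 : ℂ) • ((n : ℂ) ^ 2 • S ^ 2 + (n : ℂ) • (S * (1 - S))) -
        (4 * c ^ 2 / n : ℂ) • (n : ℂ) • S + (c : ℂ) ^ 2 • 1 -
        (((2 * c : ℝ) : ℂ) • S - (c : ℂ) • 1) * (((2 * c : ℝ) : ℂ) • S - (c : ℂ) • 1) =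
        (4 * c ^ 2 / n : ℂ) • (S * (1 - S)) := by
      simp only [sub_mul, mul_sub, smul_mul_assoc, mul_smul_comm, mul_one, one_mul, sq S]
      push_cast
      match_scalars <;> field_simp <;> ring
    rw [e, norm_smul]
    have h4 : ‖(4 * c ^ 2 / n : ℂ)‖ = 4 * c ^ 2 / n := by
      rw [show (4 * c ^ 2 / n : ℂ) = ((4 * c ^ 2 / n : ℝ) : ℂ) by push_cast; rfl,
        Complex.norm_of_nonneg (by positivity)]
    rw [h4, div_mul_eq_mul_div, div_le_iff₀ hn0]
    rw [div_lt_iff₀ hδ] at hn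
    linarith

end LHS
end CVSteering

namespace CVSteering
open MeasureTheory

/-! ### The steering inequality for bounded observables. -/

section LHSInequality

variable {H K : Type*} [NormedAddCommGroup H] [InnerProductSpace ℂ H] [CompleteSpace H]
  [NormedAddCommGroup K] [InnerProductSpace ℂ K] [CompleteSpace K]

/-- The model provides measurable matrix elements only. Separability makes the basis countable, and
the trace is then a countable sum of measurable functions. -/
theorem measurable_expect [TopologicalSpace.SeparableSpace K] {L : Type*} [MeasurableSpace L]
    {σ : L → DensityOperator K} (hσ : ∀ x y : K, Measurable fun l => inner ℂ x ((σ l).op y))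
    (F : K →L[ℂ] K) : Measurable fun l => expect (σ l) F := by
  have : Countable (basisIndex K) := (stdBasis K).countable
  simp_rw [← opTrace_comp_eq_expect]
  exact Measurable.tsum fun i => hσ _ _

theorem tensorOp_sub_right (E : H →L[ℂ] H) (F F' : K →L[ℂ] K) :
    tensorOp E (F - F') = tensorOp E F - tensorOp E F' := map_sub (tensorOpRight E) F F'

theorem tensorOp_smul_right (E : H →L[ℂ] H) (c : ℂ) (F : K →L[ℂ] K) :
    tensorOp E (c • F) = c • tensorOp E F := map_smul (tensorOpRight E) c F

theorem tensorOp_sum_smul_left {m : ℕ} (t : Fin m → ℂ) (E : Fin m → H →L[ℂ] H) (F : K →L[ℂ] K) :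
    tensorOp (∑ a, t a • E a) F = ∑ a, t a • tensorOp (E a) F := by
  rw [← tensorOpLeft_apply, map_sum]
  simp only [map_smul, tensorOpLeft_apply]

theorem norm_tensorOp_one_le (E : H →L[ℂ] H) : ‖tensorOp E (1 : K →L[ℂ] K)‖ ≤ ‖E‖ := by
  refine ContinuousLinearMap.opNorm_le_bound _ (norm_nonneg _) fun z => ?_
  induction z using UniformSpace.Completion.induction_on with
  | hp => exact isClosed_le (by fun_prop) (by fun_prop)
  | ih a =>
    rw [tensorOp, ContinuousLinearMap.completion_apply_coe, UniformSpace.Completion.norm_coe,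
      UniformSpace.Completion.norm_coe]
    refine ((TensorProduct.mapL E 1).le_opNorm a).trans ?_
    gcongr
    refine (TensorProduct.norm_mapL_le _ _).trans ?_
    exact mul_le_of_le_one_right (norm_nonneg _) ContinuousLinearMap.norm_id_le

theorem integrable_mul_expect {L : Type*} [MeasurableSpace L] {P : Measure L} [IsProbabilityMeasure P]
    {σ : L → DensityOperator K} (hσ : ∀ F : K →L[ℂ] K, Measurable fun l => expect (σ l) F)
    {τ : L → ℝ} (hτ : Measurable τ) {C : ℝ} (hC : ∀ l, |τ l| ≤ C) (F : K →L[ℂ] K) :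
    Integrable (fun l => (τ l : ℂ) * expect (σ l) F) P := by
  refine Integrable.of_bound (C := C * ‖F‖)
    ((Complex.measurable_ofReal.comp hτ).mul (hσ F)).aestronglyMeasurable (.of_forall fun l => ?_)
  rw [norm_mul, Complex.norm_real, Real.norm_eq_abs]
  exact mul_le_mul (hC l) (norm_expect_le _ _) (norm_nonneg _) ((abs_nonneg _).trans (hC l))

/-- A local hidden state model predicts the expectation value of a bounded observable of Bob, and
of its product with any bounded observable `T` of Alice, through a function of the hidden variable
that plays the role of the value of `T`. -/
theorem NonsteerableAtoB.exists_values [TopologicalSpace.SeparableSpace K]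
    {ρ : DensityOperator (HilbertTensor H K)} (h : NonsteerableAtoB ρ) :
    ∃ (L : Type) (_ : MeasurableSpace L) (P : Measure L) (σ : L → DensityOperator K),
      IsProbabilityMeasure P ∧ (∀ F : K →L[ℂ] K, Measurable fun l => expect (σ l) F) ∧
      (∀ F : K →L[ℂ] K, IsSelfAdjoint F →
        expect ρ (tensorOp 1 F) = ∫ l, expect (σ l) F ∂P) ∧
      ∀ T : H →L[ℂ] H, IsSelfAdjoint T → ∀ δ : ℝ, 0 < δ → ∃ τ s : L → ℝ,
        Measurable τ ∧ (∃ C, ∀ l, |τ l| ≤ C) ∧ Integrable s P ∧ (∀ l, τ l ^ 2 ≤ s l) ∧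
        (∫ l, s l ∂P) ≤ (expect ρ (tensorOp (T * T) 1)).re + δ ∧
        ∀ F : K →L[ℂ] K, IsSelfAdjoint F →
          expect ρ (tensorOp T F) = ∫ l, (τ l : ℂ) * expect (σ l) F ∂P := by
  obtain ⟨L, mL, P, σ, p, hP, hσ, hp, hp1, hmodel⟩ := h
  have hE := fun F : K →L[ℂ] K => measurable_expect hσ F
  have hpC : ∀ (m : ℕ) (A : POVM H m) (a : Fin m) (l : L), |p A a l| ≤ 1 := by
    intro m A a l
    rw [abs_of_nonneg ((hp m A a).2 l), ← hp1 m A l]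
    exact Finset.single_le_sum (f := fun a => p A a l) (fun a _ => (hp m A a).2 l)
      (Finset.mem_univ a)
  have heff : ∀ (m : ℕ) (A : POVM H m) (a : Fin m) (F : K →L[ℂ] K), 0 ≤ F → F ≤ 1 →
      expect ρ (tensorOp (A.effect a) F) = ∫ l, (p A a l : ℂ) * expect (σ l) F ∂P := by
    intro m A a F h0 h1
    -- An effect of Bob is an outcome of the two-valued measurement `{F, 1 - F}`, to which the model
    -- applies.
    let B : POVM K 2 :=
      { effect := ![F, 1 - F]
        isPositive := by
          intro b
          rw [← ContinuousLinearMap.nonneg_iff_isPositive]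
          fin_cases b
          · exact h0
          · exact sub_nonneg.2 h1
        sum_eq_one := by simp }
    have := hmodel m A 2 B a 0
    simp_rw [opTrace_comp_eq_expect] at this
    exact this
  have hsa : ∀ (m : ℕ) (A : POVM H m) (a : Fin m) (F : K →L[ℂ] K), IsSelfAdjoint F →
      expect ρ (tensorOp (A.effect a) F) = ∫ l, (p A a l : ℂ) * expect (σ l) F ∂P := by
    intro m A a F hF
    -- Both sides are linear in `F`, and a self-adjoint operator is a combination of the effects `S`
    -- and `1`.
    obtain ⟨c, S, -, h0, h1, rfl⟩ := exists_effect hF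
    have h01 : (0 : K →L[ℂ] K) ≤ 1 := 
      (ContinuousLinearMap.nonneg_iff_isPositive _).2 ContinuousLinearMap.isPositive_one
    rw [tensorOp_sub_right, tensorOp_smul_right, tensorOp_smul_right, expect_sub, expect_smul,
      expect_smul, heff m A a S h0 h1, heff m A a 1 h01 le_rfl, ← integral_const_mul,
      ← integral_const_mul, ← integral_sub]
    · refine integral_congr_ae (.of_forall fun l => ?_)
      simp only [expect_sub, expect_smul]
      ring
    · exact (integrable_mul_expect hE (hp m A a).1 (hpC m A a) S).const_mul _
    · exact (integrable_mul_expect hE (hp m A a).1 (hpC m A a) 1).const_mul _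
  have hsum : ∀ (m : ℕ) (A : POVM H m) (t : Fin m → ℝ) (F : K →L[ℂ] K), IsSelfAdjoint F →
      expect ρ (tensorOp (∑ a, (t a : ℂ) • A.effect a) F) =
        ∫ l, ((∑ a, t a * p A a l : ℝ) : ℂ) * expect (σ l) F ∂P := by
    intro m A t F hF
    rw [tensorOp_sum_smul_left, expect_sum]
    simp_rw [expect_smul, hsa m A _ F hF, ← integral_const_mul]
    rw [← integral_finsetSum _ fun a _ =>
      (integrable_mul_expect hE (hp m A a).1 (hpC m A a) F).const_mul _]
    refine integral_congr_ae (.of_forall fun l => ?_)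
    push_cast
    rw [Finset.sum_mul]
    exact Finset.sum_congr rfl fun a _ => by ring
  have hmeas : ∀ (m : ℕ) (A : POVM H m) (t : Fin m → ℝ),
      Measurable fun l => ∑ a, t a * p A a l := fun m A t =>
    Finset.measurable_sum _ fun a _ => (hp m A a).1.const_mul _
  have hbound : ∀ (m : ℕ) (A : POVM H m) (t : Fin m → ℝ) (l : L),
      |∑ a, t a * p A a l| ≤ ∑ a, |t a| := fun m A t l =>
    (Finset.abs_sum_le_sum_abs _ _).trans (Finset.sum_le_sum fun a _ => by
      rw [abs_mul]; exact mul_le_of_le_one_right (abs_nonneg _) (hpC m A a l))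
  refine ⟨L, mL, P, σ, hP, hE, fun F hF => ?_, fun T hT δ hδ => ?_⟩
  -- Any measurement of Alice serves here: giving every outcome the value `1` sums her out.
  · obtain ⟨m, A, -⟩ := exists_povm (IsSelfAdjoint.zero (H →L[ℂ] H)) one_pos
    have := hsum m A (fun _ => 1) F hF
    simpa only [Complex.ofReal_one, one_smul, one_mul, A.sum_eq_one, hp1] using this
  · obtain ⟨m, A, t, h1, h2⟩ := exists_povm hT hδ
    refine ⟨fun l => ∑ a, t a * p A a l, fun l => ∑ a, t a ^ 2 * p A a l, hmeas m A t,
      ⟨_, hbound m A t⟩, Integrable.of_bound (hmeas m A _).aestronglyMeasurable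
        _ (Filter.Eventually.of_forall fun l => hbound m A _ l), fun l => ?_, ?_, fun F hF => ?_⟩
    -- Jensen: the conditional variance of Alice's outcome around its mean `τ l` is nonnegative.
    · have h0 : 0 ≤ ∑ a, (t a - ∑ b, t b * p A b l) ^ 2 * p A a l :=
        Finset.sum_nonneg fun a _ => mul_nonneg (sq_nonneg _) ((hp m A a).2 l)
      have h3 : ∀ c : ℝ, ∑ a, (t a - c) ^ 2 * p A a l =
          ∑ a, t a ^ 2 * p A a l - 2 * c * ∑ a, t a * p A a l + c ^ 2 := by
        intro c
        rw [Finset.mul_sum, ← mul_one (c ^ 2), ← hp1 m A l, Finset.mul_sum,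
          ← Finset.sum_sub_distrib, ← Finset.sum_add_distrib]
        exact Finset.sum_congr rfl fun a _ => by ring
      rw [h3] at h0
      nlinarith
    · have h3 := hsum m A (fun a => t a ^ 2) 1 (IsSelfAdjoint.one _)
      simp_rw [expect_one, mul_one] at h3
      rw [integral_complex_ofReal] at h3
      have h4 : ‖expect ρ (tensorOp (∑ a, ((t a ^ 2 : ℝ) : ℂ) • A.effect a) 1) -
          expect ρ (tensorOp (T * T) 1)‖ ≤ δ := by
        rw [← expect_sub, ← tensorOpLeft_apply, ← tensorOpLeft_apply, ← map_sub]
        exact (norm_expect_le _ _).trans ((norm_tensorOp_one_le _).trans h2)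
      rw [h3] at h4
      have h5 := (abs_le.1 ((Complex.abs_re_le_norm _).trans h4)).2
      rw [Complex.sub_re, Complex.ofReal_re] at h5
      linarith
    · rw [← h1]
      exact hsum m A t F hF

/-- The steering inequality for bounded observables. -/
theorem NonsteerableAtoB.bounded_inequality [TopologicalSpace.SeparableSpace K]
    {ρ : DensityOperator (HilbertTensor H K)} (h : NonsteerableAtoB ρ)
    {T₁ T₂ : H →L[ℂ] H} {R₁ R₂ : K →L[ℂ] K} (hT₁ : IsSelfAdjoint T₁) (hT₂ : IsSelfAdjoint T₂)
    (hR₁ : IsSelfAdjoint R₁) (hR₂ : IsSelfAdjoint R₂) :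
    0 ≤ (expect ρ ((tensorOp T₁ 1 + tensorOp 1 R₁) * (tensorOp T₁ 1 + tensorOp 1 R₁))).re +
      (expect ρ ((tensorOp T₂ 1 + tensorOp 1 R₂) * (tensorOp T₂ 1 + tensorOp 1 R₂))).re +
      (expect ρ (tensorOp 1 (Complex.I • (R₁ * R₂ - R₂ * R₁)))).re := by
  obtain ⟨L, mL, P, σ, hP, hE, h1, h2⟩ := h.exists_values
  have hD : IsSelfAdjoint (Complex.I • (R₁ * R₂ - R₂ * R₁)) := by
    rw [IsSelfAdjoint, star_smul, star_sub, star_mul, star_mul, hR₁.star_eq, hR₂.star_eq,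
      Complex.star_def, Complex.conj_I]
    module
  set D := Complex.I • (R₁ * R₂ - R₂ * R₁) with hDdef
  have hsq : ∀ (T : H →L[ℂ] H) (R : K →L[ℂ] K),
      (expect ρ ((tensorOp T 1 + tensorOp 1 R) * (tensorOp T 1 + tensorOp 1 R))).re =
      (expect ρ (tensorOp (T * T) 1)).re + 2 * (expect ρ (tensorOp T R)).re +
        (expect ρ (tensorOp 1 (R * R))).re := by
    intro T R
    simp only [add_mul, mul_add, tensorOp_mul, mul_one, one_mul, expect_add, Complex.add_re]
    ring
  rw [hsq, hsq]
  have hint : ∀ {F : K →L[ℂ] K}, Integrable (fun l => expect (σ l) F) P := fun {F} => by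
    simpa using integrable_mul_expect (P := P) hE (τ := fun _ => 1) measurable_const (C := 1)
      (by simp) F
  have hre1 : ∀ F : K →L[ℂ] K, IsSelfAdjoint F →
      (expect ρ (tensorOp 1 F)).re = ∫ l, (expect (σ l) F).re ∂P := fun F hF => by
    rw [h1 F hF]; exact (integral_re hint).symm
  have hsR₁ : IsSelfAdjoint (R₁ * R₁) := by rw [IsSelfAdjoint, star_mul, hR₁.star_eq]
  have hsR₂ : IsSelfAdjoint (R₂ * R₂) := by rw [IsSelfAdjoint, star_mul, hR₂.star_eq]
  -- The two POVMs reproduce `⟨T₁²⟩` and `⟨T₂²⟩` up to `δ / 2` each.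
  refine le_of_forall_pos_le_add fun δ hδ => ?_
  obtain ⟨τ₁, s₁, hτ₁, ⟨C₁, hC₁⟩, hs₁, hle₁, hi₁, hf₁⟩ := h2 T₁ hT₁ (δ / 2) (by linarith)
  obtain ⟨τ₂, s₂, hτ₂, ⟨C₂, hC₂⟩, hs₂, hle₂, hi₂, hf₂⟩ := h2 T₂ hT₂ (δ / 2) (by linarith)
  have hint₁ := integrable_mul_expect (P := P) hE hτ₁ hC₁ R₁
  have hint₂ := integrable_mul_expect (P := P) hE hτ₂ hC₂ R₂
  have hre₁ : (expect ρ (tensorOp T₁ R₁)).re = ∫ l, τ₁ l * (expect (σ l) R₁).re ∂P := by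
    rw [hf₁ R₁ hR₁]
    refine (integral_re hint₁).symm.trans (integral_congr_ae (.of_forall fun l => ?_))
    exact Complex.re_ofReal_mul _ _
  have hre₂ : (expect ρ (tensorOp T₂ R₂)).re = ∫ l, τ₂ l * (expect (σ l) R₂).re ∂P := by
    rw [hf₂ R₂ hR₂]
    refine (integral_re hint₂).symm.trans (integral_congr_ae (.of_forall fun l => ?_))
    exact Complex.re_ofReal_mul _ _
  have hI₁ : Integrable (fun l => τ₁ l * (expect (σ l) R₁).re) P :=
    hint₁.re.congr (.of_forall fun l => Complex.re_ofReal_mul _ _)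
  have hI₂ : Integrable (fun l => τ₂ l * (expect (σ l) R₂).re) P :=
    hint₂.re.congr (.of_forall fun l => Complex.re_ofReal_mul _ _)
  have hIr : ∀ {F : K →L[ℂ] K}, Integrable (fun l => (expect (σ l) F).re) P := fun {F} => hint.re
  rw [hre1 _ hsR₁, hre1 _ hsR₂, hre1 _ hD, hre₁, hre₂]
  have hpos : 0 ≤ ∫ l, ((s₁ l + 2 * (τ₁ l * (expect (σ l) R₁).re) + (expect (σ l) (R₁ * R₁)).re) +
      (s₂ l + 2 * (τ₂ l * (expect (σ l) R₂).re) + (expect (σ l) (R₂ * R₂)).re) +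
      (expect (σ l) D).re) ∂P := by
    refine integral_nonneg fun l => ?_
    -- The cross terms of `G* G` give the commutator of Bob's operators; the real scalars `τ₁ l`,
    -- `τ₂ l` commute with everything and do not contribute to it.
    set G : K →L[ℂ] K := (R₁ + (τ₁ l : ℂ) • 1) + Complex.I • (R₂ + (τ₂ l : ℂ) • 1)
    have hG : star G * G = (R₁ * R₁ + (2 * τ₁ l : ℂ) • R₁ + ((τ₁ l : ℂ) ^ 2) • 1) +
        (R₂ * R₂ + (2 * τ₂ l : ℂ) • R₂ + ((τ₂ l : ℂ) ^ 2) • 1) + D := by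
      simp only [G, D, star_add, star_smul, hR₁.star_eq, hR₂.star_eq, star_one, Complex.star_def,
        Complex.conj_I, Complex.conj_ofReal, add_mul, mul_add, smul_mul_assoc, mul_smul_comm,
        mul_one, one_mul, smul_add, smul_smul]
      match_scalars <;> (try simp only [map_mul, Complex.conj_I, Complex.conj_ofReal]) <;> ring_nf <;>
        (try simp only [Complex.I_sq]) <;> ring
    have h0 := expect_adjoint_mul_self (σ l) G
    rw [hG] at h0
    have h3 := congrArg Complex.re h0
    simp only [expect_add, expect_smul, expect_one, Complex.add_re, Complex.ofReal_re, mul_one]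
      at h3
    have e1 : ∀ (r : ℝ) (z : ℂ), (2 * (r : ℂ) * z).re = 2 * (r * z.re) := fun r z => by
      simp [mul_assoc]
    have e2 : ∀ r : ℝ, ((r : ℂ) ^ 2).re = r ^ 2 := fun r => by
      rw [← Complex.ofReal_pow, Complex.ofReal_re]
    rw [e1, e1, e2, e2] at h3
    have h4 : 0 ≤ ∑' i, ‖G (rootVec (σ l) i)‖ ^ 2 := tsum_nonneg fun i => sq_nonneg _
    have := hle₁ l
    have := hle₂ l
    simp only [Pi.zero_apply]
    linarith
  have J : ∀ {s τ : L → ℝ} {R : K →L[ℂ] K}, Integrable s P →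
      Integrable (fun l => τ l * (expect (σ l) R).re) P →
      Integrable (fun l => s l + 2 * (τ l * (expect (σ l) R).re) + (expect (σ l) (R * R)).re) P ∧
      (∫ l, (s l + 2 * (τ l * (expect (σ l) R).re) + (expect (σ l) (R * R)).re) ∂P) =
        (∫ l, s l ∂P) + 2 * (∫ l, τ l * (expect (σ l) R).re ∂P) +
          ∫ l, (expect (σ l) (R * R)).re ∂P := by
    intro s τ R hs hI
    have j1 : Integrable (fun l => s l + 2 * (τ l * (expect (σ l) R).re)) P :=
      hs.add (hI.const_mul 2)
    refine ⟨j1.add hIr, ?_⟩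
    rw [integral_add j1 hIr, integral_add hs (hI.const_mul 2), integral_const_mul]
  obtain ⟨j₁, e₁⟩ := J hs₁ hI₁
  obtain ⟨j₂, e₂⟩ := J hs₂ hI₂
  have j₃ : Integrable (fun l =>
      (s₁ l + 2 * (τ₁ l * (expect (σ l) R₁).re) + (expect (σ l) (R₁ * R₁)).re) +
      (s₂ l + 2 * (τ₂ l * (expect (σ l) R₂).re) + (expect (σ l) (R₂ * R₂)).re)) P := j₁.add j₂
  rw [integral_add j₃ hIr, integral_add j₁ j₂, e₁, e₂] at hpos
  linarith

end LHSInequality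
end CVSteering

namespace CVSteering
open MeasureTheory Filter Topology

/-! ### Weak generators and their bounded approximations. -/

section Generator

variable {E : Type*} [NormedAddCommGroup E] [InnerProductSpace ℂ E]

/-- In the weak sense, `i Ψ` is the derivative at `0` of the orbit of `Φ` under the family of
isometries `U`. -/
structure IsWeakGenerator (U : ℝ → E →L[ℂ] E) (Φ Ψ : E) : Prop where
  norm_map : ∀ s x, ‖U s x‖ = ‖x‖
  inner_map : ∀ s x y, inner ℂ (U s x) y = inner ℂ x (U (-s) y)
  map_zero : U 0 = 1
  hasDerivAt : ∃ D : Submodule ℂ E, Dense (D : Set E) ∧ ∀ χ ∈ D, ∀ s : ℝ,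
    HasDerivAt (fun s => inner ℂ (U s χ) Φ) (-Complex.I * inner ℂ (U s χ) Ψ) s

namespace IsWeakGenerator

variable {U V : ℝ → E →L[ℂ] E} {Φ Ψ Ψ₁ Ψ₂ : E}

/-- For `χ` in the dense subspace, `s ↦ ⟨U s χ, Φ⟩` has derivative at most `‖χ‖ ‖Ψ‖`. The mean value
inequality between `0` and `-s` bounds `⟨χ, U s Φ - Φ⟩`, since `U (-s)` is moved across as `U s`.
Density then allows `χ = U s Φ - Φ`. -/
theorem norm_sub_le (h : IsWeakGenerator U Φ Ψ) (s : ℝ) : ‖U s Φ - Φ‖ ≤ |s| * ‖Ψ‖ := by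
  obtain ⟨D, hD, hd⟩ := h.hasDerivAt
  have key : ∀ χ : E, ‖inner ℂ χ (U s Φ - Φ)‖ ≤ ‖χ‖ * (|s| * ‖Ψ‖) := by
    intro χ
    have hcl : IsClosed {χ : E | ‖inner ℂ χ (U s Φ - Φ)‖ ≤ ‖χ‖ * (|s| * ‖Ψ‖)} :=
      isClosed_le (by fun_prop) (by fun_prop)
    refine hcl.closure_subset_iff.2 ?_ (hD χ)
    intro χ hχ
    have hm := (convex_univ (𝕜 := ℝ) (E := ℝ)).norm_image_sub_le_of_norm_hasDerivWithin_le
      (C := ‖χ‖ * ‖Ψ‖) (x := 0) (y := -s) (fun t _ => (hd χ hχ t).hasDerivWithinAt)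
      (fun t _ => by
        rw [norm_mul, norm_neg, Complex.norm_I, one_mul, ← h.norm_map t χ]
        exact norm_inner_le_norm _ _) (Set.mem_univ _) (Set.mem_univ _)
    rw [h.inner_map, h.inner_map, neg_neg, neg_zero, h.map_zero, one_apply_eq_self,
      ← inner_sub_right, sub_zero, norm_neg, Real.norm_eq_abs] at hm
    exact hm.trans_eq (by ring)
  by_cases h0 : ‖U s Φ - Φ‖ = 0
  · rw [h0]; positivity
  · have h1 := key (U s Φ - Φ)
    rw [norm_inner_symm, inner_self_eq_norm_sq_to_K, norm_pow, RCLike.norm_ofReal,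
      abs_of_nonneg (norm_nonneg _), sq] at h1
    exact le_of_mul_le_mul_left h1 (lt_of_le_of_ne (norm_nonneg _) (Ne.symm h0))

theorem tendsto_map (h : IsWeakGenerator U Φ Ψ) : Tendsto (fun s => U s Φ) (𝓝[≠] 0) (𝓝 Φ) := by
  rw [tendsto_iff_norm_sub_tendsto_zero]
  have : Tendsto (fun s : ℝ => |s| * ‖Ψ‖) (𝓝[≠] 0) (𝓝 0) := by
    have : Tendsto (fun s : ℝ => |s| * ‖Ψ‖) (𝓝 0) (𝓝 (|0| * ‖Ψ‖)) :=
      (continuous_abs.mul continuous_const).tendsto 0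
    rw [abs_zero, zero_mul] at this
    exact this.mono_left nhdsWithin_le_nhds
  exact squeeze_zero (fun _ => norm_nonneg _) h.norm_sub_le this

end IsWeakGenerator

/-- The difference quotient `(U s Φ - Φ) / (i s)`. -/
def diffQuot (U : ℝ → E →L[ℂ] E) (Φ : E) (s : ℝ) : E := (Complex.I * s)⁻¹ • (U s Φ - Φ)

theorem tendsto_neg_punctured : Tendsto (fun s : ℝ => -s) (𝓝[≠] 0) (𝓝[≠] 0) := by
  refine tendsto_nhdsWithin_of_tendsto_nhds_of_eventually_within _ ?_ ?_
  · have := (continuous_neg (G := ℝ)).tendsto 0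
    rw [neg_zero] at this
    exact this.mono_left nhdsWithin_le_nhds
  · filter_upwards [self_mem_nhdsWithin] with s hs
    simpa using hs

namespace IsWeakGenerator

variable {U V : ℝ → E →L[ℂ] E} {Φ Ψ Ψ₁ Ψ₂ : E}

theorem norm_diffQuot_le (h : IsWeakGenerator U Φ Ψ) (s : ℝ) : ‖diffQuot U Φ s‖ ≤ ‖Ψ‖ := by
  rw [diffQuot, norm_smul, norm_inv, norm_mul, Complex.norm_I, one_mul, Complex.norm_real,
    Real.norm_eq_abs]
  by_cases hs : s = 0
  · simp [hs]
  · rw [inv_mul_le_iff₀ (abs_pos.2 hs)]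
    exact h.norm_sub_le s

/-- Weak convergence to `Ψ` together with `‖y‖ ≤ ‖Ψ‖` is strong convergence: `‖y - Ψ‖² = ‖y‖² - ‖Ψ‖²
- 2 Re ⟨y - Ψ, Ψ⟩ ≤ 2 |⟨Ψ, y - Ψ⟩|`. -/
theorem tendsto_diffQuot (h : IsWeakGenerator U Φ Ψ) :
    Tendsto (diffQuot U Φ) (𝓝[≠] 0) (𝓝 Ψ) := by
  obtain ⟨D, hD, hd⟩ := h.hasDerivAt
  have hweak : ∀ χ ∈ D, Tendsto (fun s => inner ℂ χ (diffQuot U Φ s)) (𝓝[≠] 0)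
      (𝓝 (inner ℂ χ Ψ)) := by
    intro χ hχ
    -- The chain rule with `s ↦ -s` asks for the derivative at the point `-0`; the reflection is
    -- needed because `⟨χ, U s Φ⟩ = ⟨U (-s) χ, Φ⟩`.
    have h1 := (hd χ hχ (-0)).scomp (0 : ℝ) (hasDerivAt_neg (0 : ℝ))
    rw [hasDerivAt_iff_tendsto_slope] at h1
    have h2 := h1.const_mul (Complex.I⁻¹)
    rw [neg_zero, h.map_zero, one_apply_eq_self] at h2
    have e : Complex.I⁻¹ * ((-1 : ℝ) • (-Complex.I * inner ℂ χ Ψ)) = inner ℂ χ Ψ := by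
      rw [Complex.real_smul]; push_cast; field_simp [Complex.I_ne_zero]
    rw [e] at h2
    refine h2.congr' ?_
    filter_upwards [self_mem_nhdsWithin] with s hs
    have hs0 : (s : ℂ) ≠ 0 := by exact_mod_cast hs
    rw [slope_def_module, diffQuot, inner_smul_right, inner_sub_right, Function.comp_apply,
      Function.comp_apply, h.inner_map, h.inner_map, neg_neg, neg_neg, h.map_zero,
      one_apply_eq_self, sub_zero, Complex.real_smul, mul_inv, Complex.ofReal_inv]
    ring
  rw [tendsto_iff_norm_sub_tendsto_zero, Metric.tendsto_nhds]
  intro η hη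
  -- As `‖y - Ψ‖ ≤ 2 ‖Ψ‖`, replacing `Ψ` by `χ` costs at most `η² / 4`; weak convergence against `χ`
  -- costs another `η² / 4`.
  obtain ⟨χ, hχ, hχd⟩ := Metric.mem_closure_iff.1 (hD Ψ) (η ^ 2 / (8 * (‖Ψ‖ + 1))) (by positivity)
  have h3 := Metric.tendsto_nhds.1 (hweak χ hχ) (η ^ 2 / 4) (by positivity)
  filter_upwards [h3] with s hs
  set y := diffQuot U Φ s
  have hy : ‖y‖ ≤ ‖Ψ‖ := h.norm_diffQuot_le s
  rw [dist_eq_norm, ← inner_sub_right] at hs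
  rw [dist_eq_norm] at hχd
  rw [dist_zero_right, norm_norm]
  have h4 : ‖inner ℂ Ψ (y - Ψ)‖ < η ^ 2 / 2 := by
    have e : inner ℂ Ψ (y - Ψ) = inner ℂ (Ψ - χ) (y - Ψ) + inner ℂ χ (y - Ψ) := by
      rw [← inner_add_left, sub_add_cancel]
    rw [e]
    have h5 : ‖inner ℂ (Ψ - χ) (y - Ψ)‖ ≤ η ^ 2 / (8 * (‖Ψ‖ + 1)) * (2 * ‖Ψ‖) := by
      refine (norm_inner_le_norm _ _).trans ?_
      gcongr
      exact (_root_.norm_sub_le _ _).trans (by linarith)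
    have h6 : η ^ 2 / (8 * (‖Ψ‖ + 1)) * (2 * ‖Ψ‖) ≤ η ^ 2 / 4 := by
      rw [div_mul_eq_mul_div, div_le_div_iff₀ (by positivity) (by positivity)]
      nlinarith [sq_nonneg η, norm_nonneg Ψ]
    calc _ ≤ _ := norm_add_le _ _
      _ < η ^ 2 / 4 + η ^ 2 / 4 := by linarith
      _ = _ := by ring
  have h7 : ‖y - Ψ‖ ^ 2 < η ^ 2 := by
    have e : y = (y - Ψ) + Ψ := by abel
    have h8 := norm_add_sq (𝕜 := ℂ) (y - Ψ) Ψ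
    rw [sub_add_cancel] at h8
    have h9 : ‖y‖ ^ 2 ≤ ‖Ψ‖ ^ 2 := by gcongr
    have h10 := (abs_le.1 ((RCLike.abs_re_le_norm (inner ℂ (y - Ψ) Ψ)))).1
    rw [norm_inner_symm] at h10
    linarith
  exact lt_of_pow_lt_pow_left₀ 2 hη.le h7

end IsWeakGenerator

/-- The bounded approximation `(U s - U (-s)) / (2 i s)` of the generator of `U`. -/
def centralDiff (U : ℝ → E →L[ℂ] E) (s : ℝ) : E →L[ℂ] E :=
  (2 * Complex.I * s)⁻¹ • (U s - U (-s))

theorem centralDiff_apply (U : ℝ → E →L[ℂ] E) (s : ℝ) (Φ : E) :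
    centralDiff U s Φ = (2⁻¹ : ℂ) • (diffQuot U Φ s + diffQuot U Φ (-s)) := by
  simp only [centralDiff, diffQuot, smul_apply, sub_apply, mul_inv, Complex.ofReal_neg, inv_neg]
  module

theorem isSelfAdjoint_centralDiff [CompleteSpace E] {U : ℝ → E →L[ℂ] E}
    (hU : ∀ s x y, inner ℂ (U s x) y = inner ℂ x (U (-s) y)) (s : ℝ) :
    IsSelfAdjoint (centralDiff U s) := by
  have h : ∀ s, star (U s) = U (-s) := fun s => by
    rw [ContinuousLinearMap.star_eq_adjoint]
    refine ((ContinuousLinearMap.eq_adjoint_iff _ _).2 fun x y => ?_).symm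
    rw [hU, neg_neg]
  rw [IsSelfAdjoint, centralDiff, star_smul, star_sub, h, h, neg_neg, Complex.star_def, map_inv₀,
    map_mul, map_mul, Complex.conj_I, Complex.conj_ofReal, map_ofNat, mul_neg, neg_mul, inv_neg]
  module

namespace IsWeakGenerator

variable {U V : ℝ → E →L[ℂ] E} {Φ Ψ Ψ₁ Ψ₂ : E}

theorem norm_centralDiff_le (h : IsWeakGenerator U Φ Ψ) (s : ℝ) : ‖centralDiff U s Φ‖ ≤ ‖Ψ‖ := by
  rw [centralDiff_apply, norm_smul]
  have h1 := norm_add_le (diffQuot U Φ s) (diffQuot U Φ (-s))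
  have h2 := h.norm_diffQuot_le s
  have h3 := h.norm_diffQuot_le (-s)
  have h4 : ‖(2⁻¹ : ℂ)‖ = 2⁻¹ := by simp
  rw [h4]
  linarith

theorem tendsto_centralDiff (h : IsWeakGenerator U Φ Ψ) :
    Tendsto (fun s => centralDiff U s Φ) (𝓝[≠] 0) (𝓝 Ψ) := by
  simp_rw [centralDiff_apply]
  have := (h.tendsto_diffQuot.add (h.tendsto_diffQuot.comp tendsto_neg_punctured)).const_smul
    (2⁻¹ : ℂ)
  rwa [← two_smul ℂ Ψ, inv_smul_smul₀ two_ne_zero] at this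

/-- The canonical commutation relation in the sense of forms, from the Weyl relation. -/
theorem inner_sub_inner (h₁ : IsWeakGenerator U Φ Ψ₁) (h₂ : IsWeakGenerator V Φ Ψ₂) {c : ℝ}
    (hUV : ∀ s x, U s (V s x) = Complex.exp (-Complex.I * (s ^ 2 * c : ℝ)) • V s (U s x)) :
    inner ℂ Ψ₁ Ψ₂ - inner ℂ Ψ₂ Ψ₁ = Complex.I * c * ((‖Φ‖ ^ 2 : ℝ) : ℂ) := by
  -- With `-s` in the left argument, `⟨U (-s) Φ - Φ, V s Φ - Φ⟩` equals `⟨Φ, U s V s Φ⟩` plus terms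
  -- symmetric in `U` and `V`. These cancel in the difference, and the Weyl relation evaluates what
  -- is left.
  have l₁ := ((h₁.tendsto_diffQuot.comp tendsto_neg_punctured).inner (𝕜 := ℂ)
    h₂.tendsto_diffQuot).sub ((h₂.tendsto_diffQuot.comp tendsto_neg_punctured).inner (𝕜 := ℂ)
    h₁.tendsto_diffQuot)
  have hexp : Tendsto (fun s : ℝ => ((s ^ 2 : ℝ) : ℂ)⁻¹ *
      (Complex.exp (-Complex.I * (s ^ 2 * c : ℝ)) - 1)) (𝓝[≠] 0) (𝓝 (-Complex.I * c)) := by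
    have h1 : HasDerivAt (fun t : ℝ => Complex.exp (-Complex.I * (t * c : ℝ)))
        (-Complex.I * c) 0 := by
      have h2 : HasDerivAt (fun t : ℝ => -Complex.I * ((t * c : ℝ) : ℂ)) (-Complex.I * c) 0 := by
        have := (((hasDerivAt_id (0 : ℝ)).mul_const c).ofReal_comp).const_mul (-Complex.I)
        simpa using this
      have := h2.cexp
      simpa using this
    rw [hasDerivAt_iff_tendsto_slope] at h1
    have h3 : Tendsto (fun s : ℝ => s ^ 2) (𝓝[≠] 0) (𝓝[≠] 0) := by
      refine tendsto_nhdsWithin_of_tendsto_nhds_of_eventually_within _ ?_ ?_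
      · have := (continuous_pow (M := ℝ) 2).tendsto 0
        rw [zero_pow two_ne_zero] at this
        exact this.mono_left nhdsWithin_le_nhds
      · filter_upwards [self_mem_nhdsWithin] with s hs
        simpa using hs
    refine (h1.comp h3).congr fun s => ?_
    simp [slope_def_module]
  have l₂ : Tendsto (fun s : ℝ => -(((s ^ 2 : ℝ) : ℂ)⁻¹ *
      (Complex.exp (-Complex.I * (s ^ 2 * c : ℝ)) - 1)) * inner ℂ (V (-s) Φ) (U s Φ))
      (𝓝[≠] 0) (𝓝 (-(-Complex.I * c) * inner ℂ Φ Φ)) :=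
    hexp.neg.mul ((h₂.tendsto_map.comp tendsto_neg_punctured).inner h₁.tendsto_map)
  have e : inner ℂ Φ Φ = ((‖Φ‖ ^ 2 : ℝ) : ℂ) := by
    rw [inner_self_eq_norm_sq_to_K]; push_cast; rfl
  rw [e, show -(-Complex.I * c) = Complex.I * (c : ℂ) by ring] at l₂
  refine tendsto_nhds_unique l₁ (l₂.congr fun s => ?_)
  simp only [Function.comp_apply, diffQuot, inner_smul_left, inner_smul_right, inner_sub_left,
    inner_sub_right, h₁.inner_map, h₂.inner_map, neg_neg, hUV, map_inv₀, map_mul, Complex.conj_I,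
    Complex.conj_ofReal, Complex.ofReal_neg, map_neg]
  have e2 : (-Complex.I * -(s : ℂ))⁻¹ = (Complex.I * s)⁻¹ := by ring
  have e3 : (Complex.I * (s : ℂ))⁻¹ * (Complex.I * s)⁻¹ = -((s ^ 2 : ℝ) : ℂ)⁻¹ := by
    rw [← mul_inv, ← inv_neg]; congr 1; push_cast; linear_combination (s : ℂ) ^ 2 * Complex.I_sq
  rw [e2]
  linear_combination (-(Complex.exp (-Complex.I * (s ^ 2 * c : ℝ)) - 1) *
    inner ℂ Φ (V s (U s Φ))) * e3

end IsWeakGenerator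

end Generator
end CVSteering

namespace CVSteering
open MeasureTheory Filter Topology

/-! ### Weyl operators on Schwartz functions and on `L²`. -/

section Weyl

variable {n : ℕ}

/-- The coefficients of the positions. -/
def posPart (a : Fin 2 × Fin n → ℝ) : Config n := WithLp.toLp 2 fun k => a (0, k)

/-- The coefficients of the momenta. -/
def momPart (a : Fin 2 × Fin n → ℝ) : Config n := WithLp.toLp 2 fun k => a (1, k)

/-- The standard symplectic form. -/
def weylForm (a b : Fin 2 × Fin n → ℝ) : ℝ :=
  inner ℝ (posPart a) (momPart b) - inner ℝ (momPart a) (posPart b)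

theorem posPart_add (a b : Fin 2 × Fin n → ℝ) : posPart (a + b) = posPart a + posPart b := rfl
theorem momPart_add (a b : Fin 2 × Fin n → ℝ) : momPart (a + b) = momPart a + momPart b := rfl
theorem posPart_smul (s : ℝ) (a : Fin 2 × Fin n → ℝ) : posPart (s • a) = s • posPart a := rfl
theorem momPart_smul (s : ℝ) (a : Fin 2 × Fin n → ℝ) : momPart (s • a) = s • momPart a := rfl

/-- The phase `α·x + α·β/2` of a Weyl operator. -/
def weylAngle (a : Fin 2 × Fin n → ℝ) (x : Config n) : ℝ :=
  inner ℝ (posPart a) x + inner ℝ (posPart a) (momPart a) / 2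

/-- Every derivative is `i ^ m` times the function, hence of modulus one. Multiplication by a Weyl
phase therefore preserves the Schwartz space. -/
theorem hasTemperateGrowth_cexp_I : Function.HasTemperateGrowth fun t : ℝ =>
    Complex.exp (Complex.I * t) := by
  have hd : ∀ m : ℕ, iteratedDeriv m (fun t : ℝ => Complex.exp (Complex.I * t)) =
      fun t : ℝ => Complex.I ^ m * Complex.exp (Complex.I * t) := by
    intro m
    induction m with
    | zero => simp
    | succ m ih =>
      rw [iteratedDeriv_succ, ih]
      funext t
      have h1 : HasDerivAt (fun t : ℝ => Complex.I * (t : ℂ)) (Complex.I * 1) t :=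
        ((hasDerivAt_id t).ofReal_comp).const_mul Complex.I
      have := (h1.cexp.const_mul (Complex.I ^ m)).deriv
      rw [this, pow_succ]
      ring
  refine ⟨(contDiff_const.mul Complex.ofRealCLM.contDiff).cexp, fun m => ⟨0, 1, fun t => ?_⟩⟩
  rw [norm_iteratedFDeriv_eq_norm_iteratedDeriv, hd, norm_mul, norm_pow, Complex.norm_I, one_pow,
    one_mul, mul_comm Complex.I, Complex.norm_exp_ofReal_mul_I]
  simp

/-- The unimodular factor of a Weyl operator. -/
def weylPhase (a : Fin 2 × Fin n → ℝ) (x : Config n) : ℂ := Complex.exp (Complex.I * weylAngle a x)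

theorem norm_weylPhase (a : Fin 2 × Fin n → ℝ) (x : Config n) : ‖weylPhase a x‖ = 1 := by
  rw [weylPhase, mul_comm, Complex.norm_exp_ofReal_mul_I]

theorem hasTemperateGrowth_weylPhase (a : Fin 2 × Fin n → ℝ) :
    Function.HasTemperateGrowth (weylPhase a) := by
  have h : Function.HasTemperateGrowth (weylAngle a) :=
    (Function.hasTemperateGrowth_inner_right (posPart a)).add (.const _)
  exact hasTemperateGrowth_cexp_I.comp h

theorem continuous_weylPhase (a : Fin 2 × Fin n → ℝ) : Continuous (weylPhase a) :=
  (hasTemperateGrowth_weylPhase a).1.continuous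

/-- The Weyl operator `exp (i ∑ aⱼ Oⱼ)` on Schwartz functions. -/
def weylSchwartz (a : Fin 2 × Fin n → ℝ) : 𝓢(Config n, ℂ) →L[ℂ] 𝓢(Config n, ℂ) :=
  SchwartzMap.smulLeftCLM ℂ (weylPhase a) ∘L SchwartzMap.compSubConstCLM ℂ (-momPart a)

theorem weylSchwartz_apply (a : Fin 2 × Fin n → ℝ) (f : 𝓢(Config n, ℂ)) (x : Config n) :
    weylSchwartz a f x = weylPhase a x * f (x + momPart a) := by
  simp [weylSchwartz, SchwartzMap.smulLeftCLM_apply_apply (hasTemperateGrowth_weylPhase a)]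

/-- The inclusion of the Schwartz functions into `L²`. -/
def toMode : 𝓢(Config n, ℂ) →L[ℂ] ModeSpace n := SchwartzMap.toLpCLM ℂ ℂ 2 volume

theorem coeFn_toMode (f : 𝓢(Config n, ℂ)) : toMode f =ᵐ[volume] f := f.coeFn_toLp 2 volume

theorem denseRange_toMode : DenseRange (toMode (n := n)) :=
  SchwartzMap.denseRange_toLpCLM (F := ℂ) ENNReal.ofNat_ne_top

theorem inner_toMode (f g : 𝓢(Config n, ℂ)) :
    inner ℂ (toMode f) (toMode g) = ∫ x, inner ℂ (f x) (g x) :=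
  SchwartzMap.inner_toL2_toL2_eq f g

theorem memLp_weyl (a : Fin 2 × Fin n → ℝ) (f : ModeSpace n) :
    MemLp (fun x => weylPhase a x * f (x + momPart a)) 2 volume := by
  have hp : MeasurePreserving (fun x : Config n => x + momPart a) volume volume :=
    measurePreserving_add_right volume (momPart a)
  have h : MemLp (fun x => f (x + momPart a)) 2 volume := (Lp.memLp f).comp_measurePreserving hp
  refine h.congr_norm ((continuous_weylPhase a).aestronglyMeasurable.mul h.1)
    (.of_forall fun x => ?_)
  rw [norm_mul, norm_weylPhase, one_mul]

/-- The Weyl operator `exp (i ∑ aⱼ Oⱼ)` on `L²`. -/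
def weylIsometry (a : Fin 2 × Fin n → ℝ) : ModeSpace n →ₗᵢ[ℂ] ModeSpace n where
  toFun f := (memLp_weyl a f).toLp
  map_add' f g := by
    rw [← MemLp.toLp_add]
    refine (MemLp.toLp_eq_toLp_iff _ _).2 ?_
    have hp := measurePreserving_add_right (volume : Measure (Config n)) (momPart a)
    filter_upwards [hp.quasiMeasurePreserving.ae (Lp.coeFn_add f g)] with x hx
    simp only [hx, Pi.add_apply]
    ring
  map_smul' c f := by
    rw [RingHom.id_apply, ← MemLp.toLp_const_smul]
    refine (MemLp.toLp_eq_toLp_iff _ _).2 ?_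
    have hp := measurePreserving_add_right (volume : Measure (Config n)) (momPart a)
    filter_upwards [hp.quasiMeasurePreserving.ae (Lp.coeFn_smul c f)] with x hx
    simp only [hx, Pi.smul_apply, smul_eq_mul]
    ring
  norm_map' f := by
    change ‖(memLp_weyl a f).toLp‖ = ‖f‖
    have hp := measurePreserving_add_right (volume : Measure (Config n)) (momPart a)
    rw [Lp.norm_toLp, Lp.norm_def, ← eLpNorm_comp_measurePreserving (Lp.memLp f).1 hp]
    congr 1
    refine eLpNorm_congr_norm_ae (.of_forall fun x => ?_)
    rw [norm_mul, norm_weylPhase, one_mul, Function.comp_apply]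

/-- The Weyl operator as a bounded operator. -/
def weylOp (a : Fin 2 × Fin n → ℝ) : ModeSpace n →L[ℂ] ModeSpace n :=
  (weylIsometry a).toContinuousLinearMap

theorem weylOp_toMode (a : Fin 2 × Fin n → ℝ) (f : 𝓢(Config n, ℂ)) :
    weylOp a (toMode f) = toMode (weylSchwartz a f) := by
  have hp := measurePreserving_add_right (volume : Measure (Config n)) (momPart a)
  refine Lp.ext ?_
  filter_upwards [(memLp_weyl a (toMode f)).coeFn_toLp, coeFn_toMode (weylSchwartz a f),
    hp.quasiMeasurePreserving.ae (coeFn_toMode f)] with x h1 h2 h3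
  rw [h2, weylSchwartz_apply, ← h3]
  exact h1

theorem mode_clm_ext {S T : ModeSpace n →L[ℂ] ModeSpace n}
    (h : ∀ f, S (toMode f) = T (toMode f)) : S = T := by
  ext1 x
  exact congrFun (denseRange_toMode.equalizer S.continuous T.continuous (funext h)) x

/-- The second phase is evaluated at a shifted point. The term `α·β/2` in `weylAngle` symmetrizes
the result, so that only the symplectic form remains and `s ↦ weylOp (s • a)` is a one-parameter
group. -/
theorem weylOp_mul (a b : Fin 2 × Fin n → ℝ) :
    weylOp a * weylOp b = Complex.exp (-Complex.I * (weylForm a b / 2 : ℝ)) • weylOp (a + b) := by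
  refine mode_clm_ext fun f => ?_
  rw [mul_apply_eq_comp, smul_apply, weylOp_toMode, weylOp_toMode, weylOp_toMode, ← map_smul]
  congr 1
  ext x
  rw [smul_apply, weylSchwartz_apply, weylSchwartz_apply, weylSchwartz_apply, smul_eq_mul,
    momPart_add, ← mul_assoc, ← mul_assoc, weylPhase, weylPhase, weylPhase, ← Complex.exp_add,
    ← Complex.exp_add, add_assoc x]
  congr 2
  simp only [weylAngle, weylForm, posPart_add, momPart_add, inner_add_left, inner_add_right,
    real_inner_comm (posPart b) (momPart a)]
  push_cast
  ring

theorem weylOp_zero : weylOp (0 : Fin 2 × Fin n → ℝ) = 1 := by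
  refine mode_clm_ext fun f => ?_
  rw [weylOp_toMode, one_apply_eq_self]
  congr 1
  ext x
  have h1 : momPart (0 : Fin 2 × Fin n → ℝ) = 0 := rfl
  have h2 : posPart (0 : Fin 2 × Fin n → ℝ) = 0 := rfl
  rw [weylSchwartz_apply, weylPhase, weylAngle, h1, h2]
  simp

theorem weylForm_self (a : Fin 2 × Fin n → ℝ) : weylForm a a = 0 := by
  rw [weylForm, real_inner_comm, sub_self]

theorem weylForm_smul_smul (s t : ℝ) (a b : Fin 2 × Fin n → ℝ) :
    weylForm (s • a) (t • b) = s * t * weylForm a b := by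
  simp only [weylForm, posPart_smul, momPart_smul, real_inner_smul_left, real_inner_smul_right]
  ring

theorem weylForm_swap (a b : Fin 2 × Fin n → ℝ) : weylForm b a = -weylForm a b := by
  rw [weylForm, weylForm, real_inner_comm, real_inner_comm (posPart a)]; ring

theorem weylOp_comm (a b : Fin 2 × Fin n → ℝ) (f : ModeSpace n) :
    weylOp a (weylOp b f) =
      Complex.exp (-Complex.I * (weylForm a b : ℝ)) • weylOp b (weylOp a f) := by
  rw [← mul_apply_eq_comp, ← mul_apply_eq_comp, weylOp_mul, weylOp_mul, add_comm b a,
    weylForm_swap a b, smul_apply, smul_apply, smul_smul, ← Complex.exp_add]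
  congr 2
  push_cast
  ring

theorem inner_weylOp (a : Fin 2 × Fin n → ℝ) (f g : ModeSpace n) :
    inner ℂ (weylOp a f) g = inner ℂ f (weylOp (-a) g) := by
  have h : weylOp a (weylOp (-a) g) = g := by
    have h1 : weylForm a (-a) = 0 := by
      have := weylForm_smul_smul 1 (-1) a a
      rw [weylForm_self, mul_zero, one_smul, neg_one_smul] at this
      exact this
    rw [← mul_apply_eq_comp, weylOp_mul, add_neg_cancel, weylOp_zero, h1]
    simp
  conv_lhs => rw [← h]
  exact (weylIsometry a).inner_map_map f _

end Weyl
end CVSteering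

namespace CVSteering
open MeasureTheory Filter Topology

/-! ### Quadratures as derivatives of the Weyl groups. -/

section WeylGenerator

variable {n : ℕ}

/-- The quadratures on Schwartz functions. -/
def schwartzQuadrature (j : Fin 2 × Fin n) : 𝓢(Config n, ℂ) →L[ℂ] 𝓢(Config n, ℂ) :=
  (![positionOp j.2, momentumOp j.2] : Fin 2 → _) j.1

/-- The linear combination `∑ aⱼ Oⱼ` of the quadratures on Schwartz functions. -/
def schwartzGenerator (a : Fin 2 × Fin n → ℝ) : 𝓢(Config n, ℂ) →L[ℂ] 𝓢(Config n, ℂ) :=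
  ∑ j, (a j : ℂ) • schwartzQuadrature j

theorem schwartzGenerator_apply (a : Fin 2 × Fin n → ℝ) (f : 𝓢(Config n, ℂ)) (x : Config n) :
    schwartzGenerator a f x =
      (inner ℝ (posPart a) x : ℝ) * f x - Complex.I * fderiv ℝ f x (momPart a) := by
  have h1 : (inner ℝ (posPart a) x : ℝ) = ∑ k, a (0, k) * x k := by
    rw [PiLp.inner_apply]
    exact Finset.sum_congr rfl fun k _ => by simp [posPart, mul_comm]
  have h2 : momPart a = ∑ k, a (1, k) • EuclideanSpace.single k (1 : ℝ) := by
    ext k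
    simp [momPart, Finset.sum_apply, Pi.single_apply]
  have h3 : ∀ k, lineDeriv ℝ f x (EuclideanSpace.single k 1) =
      fderiv ℝ f x (EuclideanSpace.single k 1) := fun k =>
    f.differentiableAt.lineDeriv_eq_fderiv
  have h4 : schwartzGenerator a f x = ∑ j, (a j : ℂ) * schwartzQuadrature j f x := by
    simp [schwartzGenerator, sum_apply]
  rw [h4, Fintype.sum_prod_type, Fin.sum_univ_two, h1, h2, map_sum]
  simp only [schwartzQuadrature, Matrix.cons_val_zero, Matrix.cons_val_one, positionOp_apply,
    momentumOp_apply, h3, map_smul, Complex.real_smul]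
  push_cast
  rw [Finset.sum_mul, Finset.mul_sum, sub_eq_add_neg, ← Finset.sum_neg_distrib]
  congr 1 <;> exact Finset.sum_congr rfl fun k _ => by ring

theorem hasDerivAt_shift (f : 𝓢(Config n, ℂ)) (x v : Config n) (s : ℝ) :
    HasDerivAt (fun s : ℝ => f (x + s • v)) (fderiv ℝ f (x + s • v) v) s := by
  have h1 : HasDerivAt (fun s : ℝ => x + s • v) v s := by
    have := ((hasDerivAt_id s).smul_const v).const_add x
    simpa using this
  exact f.differentiableAt.hasFDerivAt.comp_hasDerivAt s h1

/-- Differentiating the phase along the momentum direction yields `s α·β`, which is what the shift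
adds to `α·x`. Commuting the generator to the outside lets it later be moved across an inner
product. -/
theorem schwartzGenerator_weylSchwartz (a : Fin 2 × Fin n → ℝ) (s : ℝ) (f : 𝓢(Config n, ℂ)) :
    schwartzGenerator a (weylSchwartz (s • a) f) = weylSchwartz (s • a) (schwartzGenerator a f) := by
  ext x
  rw [schwartzGenerator_apply, weylSchwartz_apply, weylSchwartz_apply, schwartzGenerator_apply]
  have hd : HasDerivAt (fun t : ℝ => weylSchwartz (s • a) f (x + t • momPart a))
      (weylPhase (s • a) x * (Complex.I * (s * inner ℝ (posPart a) (momPart a) : ℝ) *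
        f (x + momPart (s • a)) + fderiv ℝ f (x + momPart (s • a)) (momPart a))) 0 := by
    have h1 := hasDerivAt_shift f (x + momPart (s • a)) (momPart a) 0
    have h2 : HasDerivAt (fun t : ℝ => Complex.I * ((weylAngle (s • a) (x + t • momPart a) : ℝ) : ℂ))
        (Complex.I * (s * inner ℝ (posPart a) (momPart a) : ℝ)) 0 := by
      have e : ∀ t : ℝ, weylAngle (s • a) (x + t • momPart a) =
          weylAngle (s • a) x + t * (s * inner ℝ (posPart a) (momPart a)) := fun t => by
        simp only [weylAngle, posPart_smul, momPart_smul, inner_add_right, real_inner_smul_left,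
          real_inner_smul_right]
        ring
      simp_rw [e]
      have := ((((hasDerivAt_id (0 : ℝ)).mul_const
        (s * inner ℝ (posPart a) (momPart a))).const_add
        (weylAngle (s • a) x)).ofReal_comp).const_mul Complex.I
      simpa using this
    have h3 := h2.cexp.mul h1
    simp only [zero_smul, add_zero] at h3
    refine (h3.congr_deriv ?_).congr_of_eventuallyEq (.of_forall fun t => ?_)
    · rw [weylPhase]; ring
    · simp only [Pi.mul_apply]
      rw [weylSchwartz_apply, weylPhase, add_right_comm]
  have hd' := hasDerivAt_shift (weylSchwartz (s • a) f) x (momPart a) 0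
  rw [zero_smul, add_zero] at hd'
  rw [hd'.unique hd, momPart_smul, inner_add_right, real_inner_smul_right]
  push_cast
  linear_combination (-weylPhase (s • a) x * (s * (inner ℝ (posPart a) (momPart a) : ℝ)) *
    f (x + s • momPart a)) * Complex.I_sq

theorem hasDerivAt_weylSchwartz (a : Fin 2 × Fin n → ℝ) (f : 𝓢(Config n, ℂ)) (x : Config n)
    (s : ℝ) : HasDerivAt (fun s : ℝ => weylSchwartz (s • a) f x)
      (Complex.I * weylSchwartz (s • a) (schwartzGenerator a f) x) s := by
  have h1 := hasDerivAt_shift f x (momPart a) s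
  have h2 : HasDerivAt (fun t : ℝ => Complex.I * ((weylAngle (t • a) x : ℝ) : ℂ))
      (Complex.I * (inner ℝ (posPart a) x + s * inner ℝ (posPart a) (momPart a) : ℝ)) s := by
    have e : ∀ t : ℝ, weylAngle (t • a) x =
        t * inner ℝ (posPart a) x + t ^ 2 * (inner ℝ (posPart a) (momPart a) / 2) := fun t => by
      simp only [weylAngle, posPart_smul, momPart_smul, real_inner_smul_left,
        real_inner_smul_right]
      ring
    simp_rw [e]
    have := ((((hasDerivAt_id s).mul_const (inner ℝ (posPart a) x)).add
      ((hasDerivAt_pow 2 s).mul_const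
        (inner ℝ (posPart a) (momPart a) / 2))).ofReal_comp).const_mul Complex.I
    refine this.congr_deriv ?_
    push_cast
    ring
  have h3 := h2.cexp.mul h1
  refine (h3.congr_deriv ?_).congr_of_eventuallyEq (.of_forall fun t => ?_)
  · rw [weylSchwartz_apply, schwartzGenerator_apply, weylPhase, momPart_smul, inner_add_right,
      real_inner_smul_right]
    push_cast
    linear_combination (Complex.exp (Complex.I * (weylAngle (s • a) x : ℝ)) *
      fderiv ℝ f (x + s • momPart a) (momPart a)) * Complex.I_sq
  · simp only [Pi.mul_apply]
    rw [weylSchwartz_apply, weylPhase, momPart_smul]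

/-- Peetre's inequality `1 + ‖x‖ ≤ (1 + ‖x + s v‖)(1 + |S| ‖v‖)` makes Schwartz decay uniform over
bounded shifts. -/
theorem exists_shift_bound (h : 𝓢(Config n, ℂ)) (v : Config n) (S : ℝ) (k : ℕ) :
    ∃ C : ℝ, 0 ≤ C ∧ ∀ (s : ℝ) (x : Config n), |s| ≤ S →
      ‖h (x + s • v)‖ ≤ C * ((1 + ‖x‖) ^ k)⁻¹ := by
  set C := 2 ^ k * ((Finset.Iic (k, 0)).sup fun m => SchwartzMap.seminorm ℂ m.1 m.2) h
  have hC : ∀ y, (1 + ‖y‖) ^ k * ‖h y‖ ≤ C := fun y => by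
    have := SchwartzMap.one_add_le_sup_seminorm_apply (𝕜 := ℂ) (m := (k, 0)) le_rfl le_rfl h y
    simpa only [norm_iteratedFDeriv_zero] using this
  have hC0 : 0 ≤ C := le_trans (by positivity) (hC 0)
  refine ⟨C * (1 + |S| * ‖v‖) ^ k, by positivity, fun s x hs => ?_⟩
  rw [← div_eq_mul_inv, le_div_iff₀ (by positivity), mul_comm]
  have h1 : 1 + ‖x‖ ≤ (1 + ‖x + s • v‖) * (1 + |S| * ‖v‖) := by
    have h2 : ‖x‖ ≤ ‖x + s • v‖ + |s| * ‖v‖ := by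
      have := norm_sub_le (x + s • v) (s • v)
      rwa [add_sub_cancel_right, norm_smul, Real.norm_eq_abs] at this
    have h3 : |s| * ‖v‖ ≤ |S| * ‖v‖ := 
      mul_le_mul_of_nonneg_right (hs.trans (le_abs_self S)) (norm_nonneg v)
    nlinarith [norm_nonneg (x + s • v), mul_nonneg (abs_nonneg S) (norm_nonneg v),
      mul_nonneg (norm_nonneg (x + s • v)) (mul_nonneg (abs_nonneg S) (norm_nonneg v))]
  calc (1 + ‖x‖) ^ k * ‖h (x + s • v)‖
      ≤ ((1 + ‖x + s • v‖) * (1 + |S| * ‖v‖)) ^ k * ‖h (x + s • v)‖ := by gcongr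
    _ = ((1 + ‖x + s • v‖) ^ k * ‖h (x + s • v)‖) * (1 + |S| * ‖v‖) ^ k := by
        rw [mul_pow]; ring
    _ ≤ C * (1 + |S| * ‖v‖) ^ k := by gcongr; exact hC _

/-- Differentiation under the integral. With `b = (1 + ‖x‖)^{-k} ≤ 1` integrable, the derivative is
dominated near `s` by `C |g| b ≤ C (|g|² + b)`, which is integrable for every `g` in `L²`. -/
theorem hasDerivAt_inner_weylSchwartz (a : Fin 2 × Fin n → ℝ) (f : 𝓢(Config n, ℂ))
    (g : ModeSpace n) (s : ℝ) :
    HasDerivAt (fun s : ℝ => inner ℂ (toMode (weylSchwartz (s • a) f)) g)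
      (-Complex.I * inner ℂ (toMode (weylSchwartz (s • a) (schwartzGenerator a f))) g) s := by
  have hinner : ∀ h : 𝓢(Config n, ℂ), inner ℂ (toMode h) g =
      ∫ x, g x * (starRingEnd ℂ) (h x) := fun h => by
    rw [L2.inner_def]
    refine integral_congr_ae ?_
    filter_upwards [coeFn_toMode h] with x hx
    rw [hx, RCLike.inner_apply]
  have hint : ∀ h : 𝓢(Config n, ℂ), Integrable (fun x => g x * (starRingEnd ℂ) (h x)) volume :=
    fun h => by
      refine (L2.integrable_inner (toMode h) g).congr ?_
      filter_upwards [coeFn_toMode h] with x hx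
      rw [hx, RCLike.inner_apply]
  simp_rw [hinner]
  set k := (volume : Measure (Config n)).integrablePower
  obtain ⟨C, hC0, hC⟩ := exists_shift_bound (schwartzGenerator a f) (momPart a) (|s| + 1) k
  have hb1 : Integrable (fun x : Config n => ((1 + ‖x‖) ^ k)⁻¹) volume := by
    refine (Measure.integrable_pow_neg_integrablePower (volume : Measure (Config n))).congr
      (.of_forall fun x => ?_)
    simp only
    rw [Real.rpow_neg (by positivity), Real.rpow_natCast]
  have hb2 : Integrable (fun x => ‖g x‖ ^ 2) volume := (Lp.memLp g).integrable_norm_pow two_ne_zero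
  have key := hasDerivAt_integral_of_dominated_loc_of_deriv_le (μ := (volume : Measure (Config n)))
    (F := fun s x => g x * (starRingEnd ℂ) (weylSchwartz (s • a) f x))
    (F' := fun s x => g x * (starRingEnd ℂ)
      (Complex.I * weylSchwartz (s • a) (schwartzGenerator a f) x))
    (bound := fun x => C * (‖g x‖ ^ 2 + ((1 + ‖x‖) ^ k)⁻¹)) (x₀ := s)
    (Metric.ball_mem_nhds s one_pos) (.of_forall fun t => (hint _).1) (hint _)
    ((hint (Complex.I • weylSchwartz (s • a) (schwartzGenerator a f))).1)
    (.of_forall fun x t ht => ?_) ((hb2.add hb1).const_mul C)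
    (.of_forall fun x t _ => ?_)
  · refine key.2.congr_deriv ?_
    rw [← integral_const_mul]
    refine integral_congr_ae (.of_forall fun x => ?_)
    simp only [map_mul, Complex.conj_I]
    ring
  · rw [norm_mul, RCLike.norm_conj, norm_mul, Complex.norm_I, one_mul, weylSchwartz_apply, norm_mul,
      norm_weylPhase, one_mul, momPart_smul]
    have ht' : |t| ≤ |s| + 1 := by
      rw [Metric.mem_ball, Real.dist_eq] at ht
      have := abs_sub_abs_le_abs_sub t s
      linarith
    set b := ((1 + ‖x‖) ^ k)⁻¹
    have hb0 : 0 ≤ b := by positivity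
    have hb1 : b ≤ 1 := inv_le_one_of_one_le₀ (one_le_pow₀ (by linarith [norm_nonneg x]))
    calc _ ≤ ‖g x‖ * (C * b) := by gcongr; exact hC t x ht'
      _ = C * (‖g x‖ * b) := by ring
      _ ≤ C * (‖g x‖ ^ 2 + b) := by
        gcongr
        nlinarith [sq_nonneg (‖g x‖ - b), norm_nonneg (g x)]
  · have h1 := hasDerivAt_weylSchwartz a f x t
    exact (h1.star).const_mul (g x)

/-- Positions multiply by a real function; for momenta this is integration by parts, with the sign
absorbed by the conjugate of `i`. -/
theorem schwartzQuadrature_symmetric (j : Fin 2 × Fin n) (f g : 𝓢(Config n, ℂ)) :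
    inner ℂ (toMode (schwartzQuadrature j f)) (toMode g) =
      inner ℂ (toMode f) (toMode (schwartzQuadrature j g)) := by
  rw [inner_toMode, inner_toMode]
  obtain ⟨i, k⟩ := j
  simp only [RCLike.inner_apply]
  fin_cases i
  · refine integral_congr_ae (.of_forall fun x => ?_)
    simp only [schwartzQuadrature, Fin.zero_eta, Matrix.cons_val_zero, positionOp_apply, map_mul,
      Complex.conj_ofReal]
    ring
  · have h := SchwartzMap.integral_bilinear_lineDerivOp_right_eq_neg_left
      (μ := (volume : Measure (Config n))) f g
      ((ContinuousLinearMap.mul ℝ ℂ) ∘L Complex.conjCLE.toContinuousLinearMap)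
      (EuclideanSpace.single k (1 : ℝ))
    simp only [ContinuousLinearMap.comp_apply, ContinuousLinearMap.mul_apply',
      SchwartzMap.lineDerivOp_apply] at h
    have e1 : ∀ x, g x * (starRingEnd ℂ) (schwartzQuadrature ((1 : Fin 2), k) f x) =
        Complex.I * ((starRingEnd ℂ) (lineDeriv ℝ f x (EuclideanSpace.single k 1)) * g x) :=
      fun x => by
        simp only [schwartzQuadrature, Matrix.cons_val_one, Matrix.cons_val_fin_one, momentumOp_apply, map_mul, map_neg,
          Complex.conj_I]
        ring
    have e2 : ∀ x, schwartzQuadrature ((1 : Fin 2), k) g x * (starRingEnd ℂ) (f x) =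
        -Complex.I * ((starRingEnd ℂ) (f x) * lineDeriv ℝ g x (EuclideanSpace.single k 1)) :=
      fun x => by
        simp only [schwartzQuadrature, Matrix.cons_val_one, Matrix.cons_val_fin_one, momentumOp_apply]
        ring
    simp only [Fin.mk_one, e1, e2]
    rw [integral_const_mul, integral_const_mul]
    have h' : ∫ x, (starRingEnd ℂ) (f x) * lineDeriv ℝ g x (EuclideanSpace.single k 1) =
        -∫ x, (starRingEnd ℂ) (lineDeriv ℝ f x (EuclideanSpace.single k 1)) * g x := h
    rw [h']
    ring

end WeylGenerator
end CVSteering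

namespace CVSteering
open MeasureTheory Filter Topology

/-! ### Weak identities on the domains of closures. -/

section Domains

variable {E : Type*} [NormedAddCommGroup E] [InnerProductSpace ℂ E]

theorem mk_act_mem_graph {T : E →ₗ.[ℂ] E} {x : E} (hx : x ∈ T.domain) : (x, act T x) ∈ T.graph := by
  rw [act, dif_pos hx]
  exact T.mem_graph ⟨x, hx⟩

/-- An identity between matrix elements of an operator passes to its closure. -/
theorem inner_eq_of_mem_graph_closure {V : Type*} [AddCommGroup V] [Module ℂ V]
    {j : V →ₗ[ℂ] E} (hj : Function.Injective j) {T : V →ₗ[ℂ] E} {p q : E}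
    (h : ∀ v, inner ℂ p (j v) = inner ℂ q (T v)) {x y : E}
    (hxy : (x, y) ∈ (pmapOn j hj T).closure.graph) : inner ℂ p x = inner ℂ q y := by
  have h1 : (x, y) ∈ (pmapOn j hj T).graph.topologicalClosure := by
    -- By convention the closure of a non-closable operator is the operator itself, so its graph
    -- lies in the closed graph in either case.
    by_cases hc : (pmapOn j hj T).IsClosable
    · rwa [hc.graph_closure_eq_closure_graph]
    · rw [LinearPMap.closure_def' hc] at hxy
      exact Submodule.le_topologicalClosure _ hxy
  have hcl : IsClosed {z : E × E | inner ℂ p z.1 = inner ℂ q z.2} :=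
    isClosed_eq (by fun_prop) (by fun_prop)
  refine hcl.closure_subset_iff.2 ?_ h1
  rintro ⟨x, y⟩ hz
  obtain ⟨w, hw1, hw2⟩ := (LinearPMap.mem_graph_iff _).1 hz
  set v := (LinearEquiv.ofInjective j hj).symm w with hv
  have hjv : j v = w := by
    have := congrArg Subtype.val ((LinearEquiv.ofInjective j hj).apply_symm_apply w)
    rwa [LinearEquiv.ofInjective_apply] at this
  dsimp only at hw1 hw2
  change inner ℂ p x = inner ℂ q y
  rw [← hw1, ← hw2, ← hjv, h v]
  rfl

theorem inner_eq_of_mem_graph_quadrature {n : ℕ} (j : Fin 2 × Fin n) (f : 𝓢(Config n, ℂ))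
    {x y : ModeSpace n} (h : (x, y) ∈ (quadrature j).graph) :
    inner ℂ (toMode (schwartzQuadrature j f)) x = inner ℂ (toMode f) y :=
  inner_eq_of_mem_graph_closure _ (fun g => schwartzQuadrature_symmetric j f g) h

variable {H K : Type*} [NormedAddCommGroup H] [InnerProductSpace ℂ H]
  [NormedAddCommGroup K] [InnerProductSpace ℂ K]

theorem inner_eq_of_mem_graph_tensorPMap {S : H →ₗ.[ℂ] H} {T : K →ₗ.[ℂ] K} {p q : H} {p' q' : K}
    (hS : ∀ u : S.domain, inner ℂ p (u : H) = inner ℂ q (S u))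
    (hT : ∀ w : T.domain, inner ℂ p' (w : K) = inner ℂ q' (T w)) {x y : HilbertTensor H K}
    (h : (x, y) ∈ (tensorPMap S T).graph) :
    inner ℂ (pureTensor p p') x = inner ℂ (pureTensor q q') y := by
  refine inner_eq_of_mem_graph_closure _ (fun v => ?_) h
  induction v using TensorProduct.induction_on with
  | zero => simp only [map_zero, inner_zero_right]
  | tmul u w =>
    change inner ℂ (pureTensor p p') (pureTensor (u : H) (w : K)) =
      inner ℂ (pureTensor q q') (pureTensor (S u) (T w))
    rw [inner_pureTensor, inner_pureTensor, hS, hT]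
  | add v w hv hw => rw [map_add, map_add, inner_add_right, inner_add_right, hv, hw]

end Domains

/-! ### Local quadratures generate local Weyl groups. -/

section LocalWeyl

theorem star_weylOp {n : ℕ} (a : Fin 2 × Fin n → ℝ) : star (weylOp a) = weylOp (-a) := by
  rw [ContinuousLinearMap.star_eq_adjoint]
  refine ((ContinuousLinearMap.eq_adjoint_iff _ _).2 fun x y => ?_).symm
  rw [inner_weylOp, neg_neg]

theorem weylOp_neg_mul_self {n : ℕ} (a : Fin 2 × Fin n → ℝ) : weylOp (-a) * weylOp a = 1 := by
  ext1 x
  refine ext_inner_left ℂ fun y => ?_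
  rw [mul_apply_eq_comp, ← inner_weylOp]
  exact (weylIsometry a).inner_map_map y x

/-- A weak generator from an action of the Weyl operators on a space that is generated by copies
of `L²(ℝⁿ)`. -/
theorem isWeakGenerator_of_weyl {n : ℕ} {E ι : Type*} [NormedAddCommGroup E]
    [InnerProductSpace ℂ E] [CompleteSpace E] (J : ι → ModeSpace n →L[ℂ] E)
    (hJ : Dense (Submodule.span ℂ {z | ∃ i f, z = J i (toMode f)} : Set E))
    (a : Fin 2 × Fin n → ℝ) {U : ℝ → E →L[ℂ] E}
    (hUJ : ∀ s i x, U s (J i x) = J i (weylOp (s • a) x)) (hstar : ∀ s, star (U s) = U (-s))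
    (hmul : ∀ s, U (-s) * U s = 1) (h0 : U 0 = 1) {Φ : E} {O : Fin 2 × Fin n → E}
    (hO : ∀ i j f, inner ℂ (J i (toMode (schwartzQuadrature j f))) Φ =
      inner ℂ (J i (toMode f)) (O j)) :
    IsWeakGenerator U Φ (∑ j, (a j : ℂ) • O j) := by
  have hinner : ∀ s x y, inner ℂ (U s x) y = inner ℂ x (U (-s) y) := fun s x y => by
    rw [← hstar, ContinuousLinearMap.star_eq_adjoint, ContinuousLinearMap.adjoint_inner_right]
  refine ⟨fun s x => ?_, hinner, h0, _, hJ, fun χ hχ s => ?_⟩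
  · have h1 : inner ℂ (U s x) (U s x) = inner ℂ x x := by
      rw [hinner, ← mul_apply_eq_comp, hmul, one_apply_eq_self]
    rw [@norm_eq_sqrt_re_inner ℂ, @norm_eq_sqrt_re_inner ℂ _ _ _ _ x, h1]
  · induction hχ using Submodule.span_induction with
    | zero =>
      simp only [map_zero, inner_zero_left, mul_zero]
      exact hasDerivAt_const _ _
    | add x y _ _ hx hy =>
      simp only [map_add, inner_add_left, mul_add]
      exact hx.add hy
    | smul c x _ hx =>
      simp only [map_smul, inner_smul_left, mul_left_comm (-Complex.I)]
      exact hx.const_mul _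
    | mem z hz =>
      obtain ⟨i, f, rfl⟩ := hz
      -- The adjoint of `J i` pulls `Φ` back to `L²(ℝⁿ)`, where the derivative is known.
      have h1 := hasDerivAt_inner_weylSchwartz a f (ContinuousLinearMap.adjoint (J i) Φ) s
      simp only [ContinuousLinearMap.adjoint_inner_right] at h1
      simp only [hUJ, weylOp_toMode]
      refine h1.congr_deriv ?_
      congr 1
      -- With the generator outside, its argument is again a Schwartz function, and `hO` turns each
      -- quadrature into the vector `O j`.
      rw [← schwartzGenerator_weylSchwartz, inner_sum]
      simp only [schwartzGenerator, sum_apply, smul_apply, map_sum, map_smul, sum_inner,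
        inner_smul_left, inner_smul_right, Complex.conj_ofReal, hO]

variable {M N : ℕ}

/-- The embedding `x ↦ x ⊗ y`. -/
def pureLeft (y : ModeSpace N) : ModeSpace M →L[ℂ] BipartiteSpace M N :=
  LinearMap.mkContinuous
    { toFun := fun x => pureTensor x y
      map_add' := fun x x' => pureTensor_add_left x x' y
      map_smul' := fun c x => pureTensor_smul_left c x y } ‖y‖ fun x => by
        rw [mul_comm]; exact (norm_pureTensor x y).le

/-- The embedding `y ↦ x ⊗ y`. -/
def pureRight (x : ModeSpace M) : ModeSpace N →L[ℂ] BipartiteSpace M N :=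
  LinearMap.mkContinuous
    { toFun := fun y => pureTensor x y
      map_add' := pureTensor_add_right x
      map_smul' := fun c y => pureTensor_smul_right c x y } ‖x‖ fun y => (norm_pureTensor x y).le

theorem pureLeft_apply (x : ModeSpace M) (y : ModeSpace N) : pureLeft y x = pureTensor x y := rfl

theorem pureRight_apply (x : ModeSpace M) (y : ModeSpace N) : pureRight x y = pureTensor x y := rfl

theorem isWeakGenerator_left (a : Fin 2 × Fin M → ℝ) {Φ : BipartiteSpace M N}
    (hΦ : ∀ j, Φ ∈ (localQuadrature M N (.inl j)).domain) :
    IsWeakGenerator (fun s => tensorOp (weylOp (s • a)) 1) Φ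
      (∑ j, (a j : ℂ) • act (localQuadrature M N (.inl j)) Φ) := by
  refine isWeakGenerator_of_weyl (fun y : ModeSpace N => pureLeft y) ?_ a (fun s y x => ?_)
    (fun s => ?_) (fun s => ?_) ?_ (fun y j f => ?_)
  · refine (dense_span_pureTensor (denseRange_toMode (n := M))
      (dense_univ (X := ModeSpace N))).mono (Submodule.span_mono ?_)
    rintro _ ⟨_, ⟨f, rfl⟩, y, -, rfl⟩
    exact ⟨y, f, rfl⟩
  · simp only [pureLeft_apply, tensorOp_pureTensor, one_apply_eq_self]
  · rw [star_tensorOp, star_weylOp, star_one, neg_smul]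
  · rw [tensorOp_mul, neg_smul, weylOp_neg_mul_self, one_mul, tensorOp_one]
  · rw [zero_smul, weylOp_zero, tensorOp_one]
  · exact inner_eq_of_mem_graph_tensorPMap
      (fun u => inner_eq_of_mem_graph_quadrature j f ((quadrature j).mem_graph u))
      (fun w => rfl) (mk_act_mem_graph (hΦ j))

theorem isWeakGenerator_right (b : Fin 2 × Fin N → ℝ) {Φ : BipartiteSpace M N}
    (hΦ : ∀ j, Φ ∈ (localQuadrature M N (.inr j)).domain) :
    IsWeakGenerator (fun s => tensorOp 1 (weylOp (s • b))) Φ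
      (∑ j, (b j : ℂ) • act (localQuadrature M N (.inr j)) Φ) := by
  refine isWeakGenerator_of_weyl (fun x : ModeSpace M => pureRight x) ?_ b (fun s y x => ?_)
    (fun s => ?_) (fun s => ?_) ?_ (fun x j f => ?_)
  · refine (dense_span_pureTensor (dense_univ (X := ModeSpace M))
      (denseRange_toMode (n := N))).mono (Submodule.span_mono ?_)
    rintro _ ⟨x, -, _, ⟨f, rfl⟩, rfl⟩
    exact ⟨x, f, rfl⟩
  · simp only [pureRight_apply, tensorOp_pureTensor, one_apply_eq_self]
  · rw [star_tensorOp, star_weylOp, star_one, neg_smul]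
  · rw [tensorOp_mul, neg_smul, weylOp_neg_mul_self, one_mul, tensorOp_one]
  · rw [zero_smul, weylOp_zero, tensorOp_one]
  · exact inner_eq_of_mem_graph_tensorPMap (fun u => rfl)
      (fun w => inner_eq_of_mem_graph_quadrature j f ((quadrature j).mem_graph w))
      (mk_act_mem_graph (hΦ j))

/-- A limit of expectation values of self-adjoint operators is real; symmetry of the closed
quadratures is not invoked. -/
theorem IsWeakGenerator.im_inner_eq_zero {E : Type*} [NormedAddCommGroup E]
    [InnerProductSpace ℂ E] [CompleteSpace E] {U : ℝ → E →L[ℂ] E} {Φ Ψ : E}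
    (h : IsWeakGenerator U Φ Ψ) : (inner ℂ Φ Ψ).im = 0 := by
  have h1 : Tendsto (fun s => (inner ℂ Φ (centralDiff U s Φ)).im) (𝓝[≠] 0)
      (𝓝 (inner ℂ Φ Ψ).im) :=
    (Complex.continuous_im.tendsto _).comp (tendsto_const_nhds.inner h.tendsto_centralDiff)
  refine tendsto_nhds_unique h1 (tendsto_const_nhds.congr fun s => ?_)
  have h2 := (isSelfAdjoint_centralDiff h.inner_map s).isSymmetric Φ Φ
  rw [← inner_conj_symm] at h2
  exact (Complex.conj_eq_iff_im.1 h2).symm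

theorem im_inner_act_eq_zero {Φ : BipartiteSpace M N}
    (hΦ : ∀ i, Φ ∈ (localQuadrature M N i).domain) (i : (Fin 2 × Fin M) ⊕ (Fin 2 × Fin N)) :
    (inner ℂ Φ (act (localQuadrature M N i) Φ)).im = 0 := by
  rcases i with j | j
  · have h := (isWeakGenerator_left (Pi.single j 1) fun j => hΦ (.inl j)).im_inner_eq_zero
    rwa [Finset.sum_eq_single j (fun k _ hk => by simp [Pi.single_eq_of_ne hk]) (by simp),
      Pi.single_eq_same, Complex.ofReal_one, one_smul] at h
  · have h := (isWeakGenerator_right (Pi.single j 1) fun j => hΦ (.inr j)).im_inner_eq_zero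
    rwa [Finset.sum_eq_single j (fun k _ hk => by simp [Pi.single_eq_of_ne hk]) (by simp),
      Pi.single_eq_same, Complex.ofReal_one, one_smul] at h

end LocalWeyl
end CVSteering

namespace CVSteering
open MeasureTheory Filter Topology

/-! ### Passage from bounded to unbounded observables. -/

section Limit

theorem tendsto_tsum_norm_sq {ι E : Type*} [NormedAddCommGroup E] {l : Filter ℝ}
    {x : ℝ → ι → E} {y : ι → E} {b : ι → ℝ} (hb : Summable fun i => b i ^ 2)
    (hx : ∀ i, Tendsto (fun s => x s i) l (𝓝 (y i))) (hxb : ∀ s i, ‖x s i‖ ≤ b i) :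
    Tendsto (fun s => ∑' i, ‖x s i‖ ^ 2) l (𝓝 (∑' i, ‖y i‖ ^ 2)) := by
  refine tendsto_tsum_of_dominated_convergence hb (fun i => ((hx i).norm).pow 2)
    (.of_forall fun s i => ?_)
  rw [Real.norm_of_nonneg (by positivity)]
  gcongr
  exact hxb s i

theorem summable_add_sq {ι : Type*} {b c : ι → ℝ} (hb : Summable fun i => b i ^ 2)
    (hc : Summable fun i => c i ^ 2) : Summable fun i => (b i + c i) ^ 2 := by
  refine ((hb.add hc).mul_left 2).of_nonneg_of_le (fun i => sq_nonneg _) fun i => ?_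
  nlinarith [sq_nonneg (b i - c i)]

theorem summable_sum_smul_sq {ι κ E : Type*} [NormedAddCommGroup E] [NormedSpace ℂ E]
    (s : Finset κ) (c : κ → ℂ) {O : κ → ι → E} (hO : ∀ j, Summable fun i => ‖O j i‖ ^ 2) :
    Summable fun i => ‖∑ j ∈ s, c j • O j i‖ ^ 2 := by
  classical
  induction s using Finset.induction_on with
  | empty => simp
  | insert j s hj ih =>
    have h1 : Summable fun i => ‖c j • O j i‖ ^ 2 := by
      simp_rw [norm_smul, mul_pow]
      exact (hO j).mul_left _
    refine (summable_add_sq h1 ih).of_nonneg_of_le (fun i => sq_nonneg _) fun i => ?_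
    rw [Finset.sum_insert hj]
    gcongr
    exact norm_add_le _ _

theorem inner_commutator {E : Type*} [NormedAddCommGroup E] [InnerProductSpace ℂ E]
    [CompleteSpace E] {B₁ B₂ : E →L[ℂ] E} (h₁ : IsSelfAdjoint B₁) (h₂ : IsSelfAdjoint B₂) (x : E) :
    inner ℂ x ((Complex.I • (B₁ * B₂ - B₂ * B₁)) x) =
      Complex.I * (inner ℂ (B₁ x) (B₂ x) - inner ℂ (B₂ x) (B₁ x)) := by
  have e₁ := h₁.isSymmetric x (B₂ x)
  have e₂ := h₂.isSymmetric x (B₁ x)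
  simp only [ContinuousLinearMap.coe_coe] at e₁ e₂
  rw [e₁, e₂, smul_apply, sub_apply, mul_apply_eq_comp, mul_apply_eq_comp, inner_smul_right,
    inner_sub_right]

/-- On the vectors `Φ i`, the operators `F s` converge to an operator with values `Ψ i`, and are
dominated by it. -/
structure IsApproximation {ι E : Type*} [NormedAddCommGroup E] [InnerProductSpace ℂ E]
    (F : ℝ → E →L[ℂ] E) (Φ Ψ : ι → E) : Prop where
  tendsto : ∀ i, Tendsto (fun s => F s (Φ i)) (𝓝[≠] 0) (𝓝 (Ψ i))
  norm_le : ∀ s i, ‖F s (Φ i)‖ ≤ ‖Ψ i‖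
  summable : Summable fun i => ‖Ψ i‖ ^ 2

section AbstractLimit

variable {E : Type*} [NormedAddCommGroup E] [InnerProductSpace ℂ E] [CompleteSpace E]

/-- Dominated convergence with majorant `(‖A i‖ + (‖B i‖ + |m| ‖√ρ eᵢ‖))²`. -/
theorem IsApproximation.tendsto_expect_sq {ρ : DensityOperator E} {F G : ℝ → E →L[ℂ] E}
    {A B : basisIndex E → E} (hF : IsApproximation F (rootVec ρ) A)
    (hG : IsApproximation G (rootVec ρ) B) (hFs : ∀ s, IsSelfAdjoint (F s))
    (hGs : ∀ s, IsSelfAdjoint (G s)) (m : ℝ) :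
    Tendsto (fun s => (expect ρ ((F s + (G s - (m : ℂ) • 1)) * (F s + (G s - (m : ℂ) • 1)))).re)
      (𝓝[≠] 0) (𝓝 (∑' i, ‖A i + B i - (m : ℂ) • rootVec ρ i‖ ^ 2)) := by
  have hS : ∀ s, IsSelfAdjoint (F s + (G s - (m : ℂ) • 1)) := fun s =>
    (hFs s).add ((hGs s).sub
      (IsSelfAdjoint.smul (r := (m : ℂ)) (Complex.conj_ofReal m) (IsSelfAdjoint.one _)))
  have e : ∀ s, (expect ρ ((F s + (G s - (m : ℂ) • 1)) * (F s + (G s - (m : ℂ) • 1)))).re =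
      ∑' i, ‖F s (rootVec ρ i) + (G s (rootVec ρ i) - (m : ℂ) • rootVec ρ i)‖ ^ 2 := fun s => by
    have h := expect_adjoint_mul_self ρ (F s + (G s - (m : ℂ) • 1))
    rw [(hS s).star_eq] at h
    rw [h, Complex.ofReal_re]
    simp only [add_apply, sub_apply, smul_apply, one_apply_eq_self]
  simp_rw [e]
  have hm : Summable fun i => (|m| * ‖rootVec ρ i‖) ^ 2 := by
    simp_rw [mul_pow]; exact (summable_norm_sq_rootVec ρ).mul_left _
  refine tendsto_tsum_norm_sq (summable_add_sq hF.summable (summable_add_sq hG.summable hm))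
    (fun i => ?_) (fun s i => ?_)
  · rw [add_sub_assoc]
    exact (hF.tendsto i).add ((hG.tendsto i).sub tendsto_const_nhds)
  · refine (norm_add_le _ _).trans (add_le_add (hF.norm_le s i)
      ((norm_sub_le _ _).trans (add_le_add (hG.norm_le s i) ?_)))
    rw [norm_smul, Complex.norm_real, Real.norm_eq_abs]

/-- Self-adjointness writes the commutator through `⟨F x, G x⟩` alone, so products of unbounded
operators never arise. The majorant is `‖A i‖² + ‖B i‖²`, and the limit sums to `-c` because the
trace is one. -/
theorem IsApproximation.tendsto_expect_commutator {ρ : DensityOperator E} {F G : ℝ → E →L[ℂ] E}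
    {A B : basisIndex E → E} (hF : IsApproximation F (rootVec ρ) A)
    (hG : IsApproximation G (rootVec ρ) B) (hFs : ∀ s, IsSelfAdjoint (F s))
    (hGs : ∀ s, IsSelfAdjoint (G s)) {c : ℝ}
    (hc : ∀ i, inner ℂ (A i) (B i) - inner ℂ (B i) (A i) =
      Complex.I * c * ((‖rootVec ρ i‖ ^ 2 : ℝ) : ℂ)) :
    Tendsto (fun s => (expect ρ (Complex.I • (F s * G s - G s * F s))).re) (𝓝[≠] 0) (𝓝 (-c)) := by
  have hpt : ∀ i, Complex.I * (inner ℂ (A i) (B i) - inner ℂ (B i) (A i)) =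
      ((-c * ‖rootVec ρ i‖ ^ 2 : ℝ) : ℂ) := fun i => by
    rw [hc]
    push_cast
    linear_combination ((c : ℂ) * (‖rootVec ρ i‖ : ℂ) ^ 2) * Complex.I_sq
  have hlim : Tendsto (fun s => expect ρ (Complex.I • (F s * G s - G s * F s)))
      (𝓝[≠] 0) (𝓝 (∑' i, ((-c * ‖rootVec ρ i‖ ^ 2 : ℝ) : ℂ))) := by
    simp only [expect, inner_commutator (hFs _) (hGs _), ← hpt]
    refine tendsto_tsum_of_dominated_convergence (hF.summable.add hG.summable) (fun i => ?_)
      (.of_forall fun s i => ?_)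
    · exact tendsto_const_nhds.mul (((hF.tendsto i).inner (hG.tendsto i)).sub
        ((hG.tendsto i).inner (hF.tendsto i)))
    · have h1 := hF.norm_le s i
      have h2 := hG.norm_le s i
      rw [norm_mul, Complex.norm_I, one_mul]
      refine (norm_sub_le _ _).trans ?_
      have h3 : ‖inner ℂ (F s (rootVec ρ i)) (G s (rootVec ρ i))‖ ≤ ‖A i‖ * ‖B i‖ :=
        (norm_inner_le_norm _ _).trans (by gcongr)
      rw [norm_inner_symm (G s (rootVec ρ i))]
      nlinarith [sq_nonneg (‖A i‖ - ‖B i‖)]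
  rw [← Complex.ofReal_tsum, tsum_mul_left, (hasSum_norm_sq_rootVec ρ).tsum_eq, mul_one] at hlim
  exact (Complex.continuous_re.tendsto _).comp hlim

end AbstractLimit

/-- The steering inequality for unbounded observables that are limits of bounded ones. -/
theorem NonsteerableAtoB.limit_inequality {H K : Type*} [NormedAddCommGroup H]
    [InnerProductSpace ℂ H] [CompleteSpace H] [NormedAddCommGroup K] [InnerProductSpace ℂ K]
    [CompleteSpace K] [TopologicalSpace.SeparableSpace K]
    {ρ : DensityOperator (HilbertTensor H K)} (h : NonsteerableAtoB ρ)
    {T₁ T₂ : ℝ → H →L[ℂ] H} {R₁ R₂ : ℝ → K →L[ℂ] K}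
    {A₁ A₂ B₁ B₂ : basisIndex (HilbertTensor H K) → HilbertTensor H K}
    (hT₁ : ∀ s, IsSelfAdjoint (T₁ s)) (hT₂ : ∀ s, IsSelfAdjoint (T₂ s))
    (hR₁ : ∀ s, IsSelfAdjoint (R₁ s)) (hR₂ : ∀ s, IsSelfAdjoint (R₂ s))
    (hA₁ : IsApproximation (fun s => tensorOp (T₁ s) 1) (rootVec ρ) A₁)
    (hA₂ : IsApproximation (fun s => tensorOp (T₂ s) 1) (rootVec ρ) A₂)
    (hB₁ : IsApproximation (fun s => tensorOp 1 (R₁ s)) (rootVec ρ) B₁)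
    (hB₂ : IsApproximation (fun s => tensorOp 1 (R₂ s)) (rootVec ρ) B₂) {c : ℝ}
    (hc : ∀ i, inner ℂ (B₁ i) (B₂ i) - inner ℂ (B₂ i) (B₁ i) =
      Complex.I * c * ((‖rootVec ρ i‖ ^ 2 : ℝ) : ℂ)) (m₁ m₂ : ℝ) :
    0 ≤ ∑' i, ‖A₁ i + B₁ i - (m₁ : ℂ) • rootVec ρ i‖ ^ 2 +
      ∑' i, ‖A₂ i + B₂ i - (m₂ : ℂ) • rootVec ρ i‖ ^ 2 - c := by
  have hl : ∀ {T : H →L[ℂ] H}, IsSelfAdjoint T →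
      IsSelfAdjoint (tensorOp T (1 : K →L[ℂ] K)) := fun hT => by
    rw [IsSelfAdjoint, star_tensorOp, hT.star_eq, star_one]
  have hr : ∀ {R : K →L[ℂ] K}, IsSelfAdjoint R →
      IsSelfAdjoint (tensorOp (1 : H →L[ℂ] H) R) := fun hR => by
    rw [IsSelfAdjoint, star_tensorOp, hR.star_eq, star_one]
  have hsm : ∀ {R : K →L[ℂ] K} (m : ℝ), IsSelfAdjoint R →
      IsSelfAdjoint (R - (m : ℂ) • (1 : K →L[ℂ] K)) := fun m hR =>
    hR.sub (IsSelfAdjoint.smul (r := (m : ℂ)) (Complex.conj_ofReal m) (IsSelfAdjoint.one _))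
  have l₁ := hA₁.tendsto_expect_sq hB₁ (fun s => hl (hT₁ s)) (fun s => hr (hR₁ s)) m₁
  have l₂ := hA₂.tendsto_expect_sq hB₂ (fun s => hl (hT₂ s)) (fun s => hr (hR₂ s)) m₂
  have l₃ := hB₁.tendsto_expect_commutator hB₂ (fun s => hr (hR₁ s)) (fun s => hr (hR₂ s)) hc
  rw [sub_eq_add_neg]
  refine ge_of_tendsto ((l₁.add l₂).add l₃) (.of_forall fun s => ?_)
  -- The centring constants are put into Bob's observables; scalars leave the commutator unchanged.
  have hb := h.bounded_inequality (hT₁ s) (hT₂ s) (hsm m₁ (hR₁ s)) (hsm m₂ (hR₂ s))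
  have e₁ : ∀ (R : K →L[ℂ] K) (m : ℝ), tensorOp (1 : H →L[ℂ] H) (R - (m : ℂ) • 1) =
      tensorOp 1 R - (m : ℂ) • 1 := fun R m => by
    rw [tensorOp_sub_right, tensorOp_smul_right, tensorOp_one]
  have e₂ : (R₁ s - (m₁ : ℂ) • 1) * (R₂ s - (m₂ : ℂ) • 1) -
      (R₂ s - (m₂ : ℂ) • 1) * (R₁ s - (m₁ : ℂ) • 1) = R₁ s * R₂ s - R₂ s * R₁ s := by
    simp only [sub_mul, mul_sub, smul_mul_assoc, mul_smul_comm, one_mul, mul_one]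
    module
  have e₃ : ∀ R R' : K →L[ℂ] K, tensorOp (1 : H →L[ℂ] H) (R * R') =
      tensorOp 1 R * tensorOp 1 R' := fun R R' => by rw [tensorOp_mul, one_mul]
  rw [e₂, e₁, e₁, tensorOp_smul_right, tensorOp_sub_right, e₃, e₃] at hb
  exact hb

theorem norm_inner_le_add_sq {E : Type*} [NormedAddCommGroup E] [InnerProductSpace ℂ E] (x y : E) :
    ‖inner ℂ x y‖ ≤ ‖x‖ ^ 2 + ‖y‖ ^ 2 := by
  refine (norm_inner_le_norm _ _).trans ?_
  nlinarith [sq_nonneg (‖x‖ - ‖y‖), sq_nonneg ‖x‖, sq_nonneg ‖y‖]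

/-- The variance of a linear combination of observables. -/
theorem tsum_norm_sq_sub_mean {ι κ E : Type*} [Fintype κ] [NormedAddCommGroup E]
    [InnerProductSpace ℂ E] {Φ : ι → E} (hΦ : HasSum (fun i => ‖Φ i‖ ^ 2) 1) {O : κ → ι → E}
    {μ : κ → ℂ} {g : κ → κ → ℂ} (hμ : ∀ j, HasSum (fun i => inner ℂ (Φ i) (O j i)) (μ j))
    (hg : ∀ j k, HasSum (fun i => inner ℂ (O j i) (O k i)) (g j k)) (hμ0 : ∀ j, (μ j).im = 0)
    (v : κ → ℝ) :
    ∑' i, ‖∑ j, (v j : ℂ) • O j i - ((∑ j, v j * (μ j).re : ℝ) : ℂ) • Φ i‖ ^ 2 =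
      ∑ j, ∑ k, v j * ((g j k + g k j) / 2 - μ j * μ k).re * v k := by
  set m : ℝ := ∑ j, v j * (μ j).re with hm
  have hpt : ∀ i, ‖∑ j, (v j : ℂ) • O j i - (m : ℂ) • Φ i‖ ^ 2 =
      ∑ j, ∑ k, v j * v k * (inner ℂ (O j i) (O k i)).re -
        2 * m * ∑ j, v j * (inner ℂ (Φ i) (O j i)).re + m ^ 2 * ‖Φ i‖ ^ 2 := by
    intro i
    have e1 : ‖∑ j, (v j : ℂ) • O j i‖ ^ 2 =
        ∑ j, ∑ k, v j * v k * (inner ℂ (O j i) (O k i)).re := by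
      rw [← inner_self_eq_norm_sq (𝕜 := ℂ), sum_inner, map_sum]
      refine Finset.sum_congr rfl fun j _ => ?_
      rw [inner_sum, map_sum]
      refine Finset.sum_congr rfl fun k _ => ?_
      rw [inner_smul_left, inner_smul_right, Complex.conj_ofReal, RCLike.re_to_complex,
        Complex.re_ofReal_mul, Complex.re_ofReal_mul, mul_assoc]
    have e2 : (inner ℂ (∑ j, (v j : ℂ) • O j i) ((m : ℂ) • Φ i)).re =
        m * ∑ j, v j * (inner ℂ (Φ i) (O j i)).re := by
      rw [inner_smul_right, Complex.re_ofReal_mul, sum_inner, Complex.re_sum]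
      congr 1
      refine Finset.sum_congr rfl fun j _ => ?_
      rw [inner_smul_left, Complex.conj_ofReal, Complex.re_ofReal_mul, ← inner_conj_symm,
        Complex.conj_re]
    rw [norm_sub_sq (𝕜 := ℂ), RCLike.re_to_complex, e1, e2, norm_smul, Complex.norm_real, mul_pow,
      Real.norm_eq_abs, sq_abs]
    ring
  have hS : HasSum (fun i => ‖∑ j, (v j : ℂ) • O j i - (m : ℂ) • Φ i‖ ^ 2)
      (∑ j, ∑ k, v j * v k * (g j k).re - 2 * m * ∑ j, v j * (μ j).re + m ^ 2 * 1) := by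
    have h1 : HasSum (fun i => ∑ j, ∑ k, v j * v k * (inner ℂ (O j i) (O k i)).re)
        (∑ j, ∑ k, v j * v k * (g j k).re) := by
      apply hasSum_sum
      intro j _
      apply hasSum_sum
      intro k _
      exact (Complex.hasSum_re (hg j k)).mul_left _
    have h2 : HasSum (fun i => ∑ j, v j * (inner ℂ (Φ i) (O j i)).re)
        (∑ j, v j * (μ j).re) := by
      apply hasSum_sum
      intro j _
      exact (Complex.hasSum_re (hμ j)).mul_left _
    have h3 := (h1.sub (h2.mul_left (2 * m))).add (hΦ.mul_left (m ^ 2))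
    rw [funext hpt]
    exact h3
  have hsymm : ∀ j k, (g k j).re = (g j k).re := fun j k => by
    refine (Complex.hasSum_re (hg k j)).unique ?_
    have h1 := Complex.hasSum_re (hg j k)
    have e : ∀ i, (inner ℂ (O j i) (O k i)).re = (inner ℂ (O k i) (O j i)).re := fun i => by
      rw [← inner_conj_symm, Complex.conj_re]
    simpa only [e] using h1
  -- The means are real, so the real part of their product is the product of the real parts.
  have hγ : ∀ j k, ((g j k + g k j) / 2 - μ j * μ k).re = (g j k).re - (μ j).re * (μ k).re :=
    fun j k => by
      rw [Complex.sub_re, Complex.mul_re, hμ0, hμ0, Complex.div_ofNat_re, Complex.add_re, hsymm j k]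
      ring
  have hm2 : m ^ 2 = ∑ j, ∑ k, v j * v k * ((μ j).re * (μ k).re) := by
    rw [sq, hm, Finset.sum_mul_sum]
    exact Finset.sum_congr rfl fun j _ => Finset.sum_congr rfl fun k _ => by ring
  have hfin : ∑ j, ∑ k, v j * ((g j k + g k j) / 2 - μ j * μ k).re * v k =
      ∑ j, ∑ k, v j * v k * (g j k).re - m ^ 2 := by
    rw [hm2, ← Finset.sum_sub_distrib]
    refine Finset.sum_congr rfl fun j _ => ?_
    rw [← Finset.sum_sub_distrib]
    refine Finset.sum_congr rfl fun k _ => ?_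
    rw [hγ]
    ring
  rw [hS.tsum_eq, ← hm, hfin]
  ring

end Limit
end CVSteering

namespace CVSteering
open MeasureTheory Filter Topology

/-! ### The covariance matrix inequality. -/

section Covariance

variable {M N : ℕ} {ρ : DensityOperator (BipartiteSpace M N)}

theorem isSelfAdjoint_centralDiff_weylOp {n : ℕ} (a : Fin 2 × Fin n → ℝ) (s : ℝ) :
    IsSelfAdjoint (centralDiff (fun s => weylOp (s • a)) s) :=
  isSelfAdjoint_centralDiff (fun s x y => by rw [inner_weylOp, neg_smul]) s

/-- Tensoring with `1` commutes with central differences, so these are central differences of the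
local Weyl group. Finite second moments put each `√ρ eᵢ` in the domain and make the limits square
summable. -/
theorem isApproximation_left (hρ : ∀ j, FiniteSecondMoment ρ (localQuadrature M N j))
    (a : Fin 2 × Fin M → ℝ) :
    IsApproximation (fun s => tensorOp (centralDiff (fun s => weylOp (s • a)) s) 1) (rootVec ρ)
      (fun i => ∑ j, (a j : ℂ) • act (localQuadrature M N (.inl j)) (rootVec ρ i)) := by
  have e : ∀ s, tensorOp (centralDiff (fun s => weylOp (s • a)) s)
      (1 : ModeSpace N →L[ℂ] ModeSpace N) =
      centralDiff (fun s => tensorOp (weylOp (s • a)) 1) s := fun s => by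
    rw [centralDiff, ← tensorOpLeft_apply, map_smul, map_sub]
    rfl
  have hg := fun i => isWeakGenerator_left a (Φ := rootVec ρ i) fun j => (hρ (.inl j)).1 _
  simp_rw [e]
  exact ⟨fun i => (hg i).tendsto_centralDiff, fun s i => (hg i).norm_centralDiff_le s,
    summable_sum_smul_sq _ _ fun j => (hρ (.inl j)).2⟩

theorem isApproximation_right (hρ : ∀ j, FiniteSecondMoment ρ (localQuadrature M N j))
    (b : Fin 2 × Fin N → ℝ) :
    IsApproximation (fun s => tensorOp 1 (centralDiff (fun s => weylOp (s • b)) s)) (rootVec ρ)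
      (fun i => ∑ j, (b j : ℂ) • act (localQuadrature M N (.inr j)) (rootVec ρ i)) := by
  have e : ∀ s, tensorOp (1 : ModeSpace M →L[ℂ] ModeSpace M)
      (centralDiff (fun s => weylOp (s • b)) s) =
      centralDiff (fun s => tensorOp 1 (weylOp (s • b))) s := fun s => by
    rw [centralDiff, ← tensorOpRight_apply, map_smul, map_sub]
    rfl
  have hg := fun i => isWeakGenerator_right b (Φ := rootVec ρ i) fun j => (hρ (.inr j)).1 _
  simp_rw [e]
  exact ⟨fun i => (hg i).tendsto_centralDiff, fun s i => (hg i).norm_centralDiff_le s,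
    summable_sum_smul_sq _ _ fun j => (hρ (.inr j)).2⟩

/-- The canonical commutation relations on the domains of the closed quadratures. -/
theorem inner_quadrature_commutator {Φ : BipartiteSpace M N}
    (hΦ : ∀ j, Φ ∈ (localQuadrature M N (.inr j)).domain) (b b' : Fin 2 × Fin N → ℝ) :
    inner ℂ (∑ j, (b j : ℂ) • act (localQuadrature M N (.inr j)) Φ)
        (∑ j, (b' j : ℂ) • act (localQuadrature M N (.inr j)) Φ) -
      inner ℂ (∑ j, (b' j : ℂ) • act (localQuadrature M N (.inr j)) Φ)
        (∑ j, (b j : ℂ) • act (localQuadrature M N (.inr j)) Φ) =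
      Complex.I * weylForm b b' * ((‖Φ‖ ^ 2 : ℝ) : ℂ) := by
  refine (isWeakGenerator_right b hΦ).inner_sub_inner (isWeakGenerator_right b' hΦ) fun s x => ?_
  have h : weylOp (s • b) * weylOp (s • b') =
      Complex.exp (-Complex.I * (s ^ 2 * weylForm b b' : ℝ)) • (weylOp (s • b') * weylOp (s • b)) := by
    ext1 y
    rw [smul_apply, mul_apply_eq_comp, mul_apply_eq_comp, weylOp_comm, weylForm_smul_smul, ← sq]
  rw [← mul_apply_eq_comp, ← mul_apply_eq_comp, tensorOp_mul, tensorOp_mul, h,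
    tensorOp_smul_right, smul_apply]

/-- The covariance matrix gives the variances of linear combinations of the quadratures. -/
theorem tsum_norm_sq_eq_covariance (hρ : ∀ j, FiniteSecondMoment ρ (localQuadrature M N j))
    (v : (Fin 2 × Fin M) ⊕ (Fin 2 × Fin N) → ℝ) :
    ∑' i, ‖∑ j, (v j : ℂ) • act (localQuadrature M N j) (rootVec ρ i) -
      ((∑ j, v j * (mean ρ (localQuadrature M N j)).re : ℝ) : ℂ) • rootVec ρ i‖ ^ 2 =
      ∑ j, ∑ k, v j * cvCovarianceMatrix ρ j k * v k := by
  have hsum : ∀ j, Summable fun i => ‖act (localQuadrature M N j) (rootVec ρ i)‖ ^ 2 :=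
    fun j => (hρ j).2
  have hmean : ∀ j, HasSum (fun i => inner ℂ (rootVec ρ i) (act (localQuadrature M N j)
      (rootVec ρ i))) (mean ρ (localQuadrature M N j)) := fun j =>
    (((summable_norm_sq_rootVec ρ).add (hsum j)).of_norm_bounded
      fun i => norm_inner_le_add_sq _ _).hasSum
  have hmom : ∀ j k, HasSum (fun i => inner ℂ (act (localQuadrature M N j) (rootVec ρ i))
      (act (localQuadrature M N k) (rootVec ρ i)))
      (moment ρ (localQuadrature M N j) (localQuadrature M N k)) := fun j k =>
    (((hsum j).add (hsum k)).of_norm_bounded fun i => norm_inner_le_add_sq _ _).hasSum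
  refine tsum_norm_sq_sub_mean (hasSum_norm_sq_rootVec ρ) hmean hmom (fun j => ?_) v
  have h1 := Complex.hasSum_im (hmean j)
  have e : ∀ i, (inner ℂ (rootVec ρ i) (act (localQuadrature M N j) (rootVec ρ i))).im = 0 :=
    fun i => im_inner_act_eq_zero (fun j => (hρ j).1 _) j
  simp only [e] at h1
  exact h1.unique hasSum_zero

/-- The steering inequality for linear combinations of the quadratures. -/
theorem NonsteerableAtoB.quadratic_form_nonneg (h : NonsteerableAtoB ρ)
    (hρ : ∀ j, FiniteSecondMoment ρ (localQuadrature M N j))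
    (v w : (Fin 2 × Fin M) ⊕ (Fin 2 × Fin N) → ℝ) :
    0 ≤ ∑ j, ∑ k, v j * cvCovarianceMatrix ρ j k * v k +
        ∑ j, ∑ k, w j * cvCovarianceMatrix ρ j k * w k -
        weylForm (fun j => v (.inr j)) (fun j => w (.inr j)) := by
  -- Alice's components of `v`, `w` define `T₁`, `T₂`, Bob's define `R₁`, `R₂`; subtracting the
  -- means turns second moments into variances.
  have hl := h.limit_inequality (isSelfAdjoint_centralDiff_weylOp fun j => v (.inl j))
    (isSelfAdjoint_centralDiff_weylOp fun j => w (.inl j))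
    (isSelfAdjoint_centralDiff_weylOp fun j => v (.inr j))
    (isSelfAdjoint_centralDiff_weylOp fun j => w (.inr j))
    (isApproximation_left hρ _) (isApproximation_left hρ _) (isApproximation_right hρ _)
    (isApproximation_right hρ _)
    (fun i => inner_quadrature_commutator (fun j => (hρ (.inr j)).1 _) _ _)
    (∑ j, v j * (mean ρ (localQuadrature M N j)).re)
    (∑ j, w j * (mean ρ (localQuadrature M N j)).re)
  rw [← tsum_norm_sq_eq_covariance hρ, ← tsum_norm_sq_eq_covariance hρ]
  simpa only [Fintype.sum_sum_type] using hl

theorem cvCovarianceMatrix_symm (j k : (Fin 2 × Fin M) ⊕ (Fin 2 × Fin N)) :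
    cvCovarianceMatrix ρ j k = cvCovarianceMatrix ρ k j := by
  simp only [cvCovarianceMatrix, covarianceMatrix, Matrix.of_apply]
  rw [add_comm, mul_comm (mean _ _)]

/-- The real matrix underlying the block symplectic form. -/
def realSymplecticForm (N : ℕ) : Matrix (Fin 2 × Fin N) (Fin 2 × Fin N) ℝ :=
  Matrix.blockDiagonal fun _ => !![0, 1 / 2; -1 / 2, 0]

theorem symplecticForm_eq_map (j k : Fin 2 × Fin N) :
    symplecticForm N j k = (realSymplecticForm N j k : ℂ) := by
  obtain ⟨i, l⟩ := j
  obtain ⟨i', l'⟩ := k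
  simp only [symplecticForm, realSymplecticForm, Matrix.blockDiagonal_apply]
  split_ifs
  · fin_cases i <;> fin_cases i' <;> simp
  · simp

theorem realSymplecticForm_swap (j k : Fin 2 × Fin N) :
    realSymplecticForm N k j = -realSymplecticForm N j k := by
  obtain ⟨i, l⟩ := j
  obtain ⟨i', l'⟩ := k
  simp only [realSymplecticForm, Matrix.blockDiagonal_apply, eq_comm (a := l')]
  split_ifs
  · fin_cases i <;> fin_cases i' <;> norm_num
  · simp

/-- The factor `1/2` in `Ω` is recovered later: the imaginary part of a Hermitian form contributes
the antisymmetric pair, which doubles it. -/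
theorem sum_realSymplecticForm (v w : Fin 2 × Fin N → ℝ) :
    ∑ j, ∑ k, v j * realSymplecticForm N j k * w k = weylForm v w / 2 := by
  have h : ∀ (i i' : Fin 2) (l : Fin N), ∑ l', v (i, l) * realSymplecticForm N (i, l) (i', l') *
      w (i', l') = v (i, l) * (!![0, 1 / 2; -1 / 2, 0] : Matrix (Fin 2) (Fin 2) ℝ) i i' *
        w (i', l) := fun i i' l => by
    rw [Finset.sum_eq_single l]
    · simp [realSymplecticForm, Matrix.blockDiagonal_apply]
    · intro l' _ hl
      simp [realSymplecticForm, Matrix.blockDiagonal_apply, hl.symm]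
    · simp
  simp only [Fintype.sum_prod_type, Fin.sum_univ_two, h, weylForm, posPart, momPart,
    PiLp.inner_apply, RCLike.inner_apply, conj_trivial, ← Finset.sum_add_distrib,
    ← Finset.sum_sub_distrib, Finset.sum_div]
  refine Finset.sum_congr rfl fun l _ => ?_
  simp
  ring

-- For `x = p + i q` the Hermitian form has real part `p·γp + q·γq + ω(p_B, q_B)`, and its imaginary
-- part vanishes because the matrix is Hermitian.
open scoped ComplexOrder in
theorem satisfiesCVC_of_quadratic
    (h : ∀ v w : (Fin 2 × Fin M) ⊕ (Fin 2 × Fin N) → ℝ,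
      0 ≤ ∑ j, ∑ k, v j * cvCovarianceMatrix ρ j k * v k +
        ∑ j, ∑ k, w j * cvCovarianceMatrix ρ j k * w k -
        weylForm (fun j => v (.inr j)) (fun j => w (.inr j))) :
    SatisfiesCVC ρ := by
  set ω : Matrix ((Fin 2 × Fin M) ⊕ (Fin 2 × Fin N)) ((Fin 2 × Fin M) ⊕ (Fin 2 × Fin N)) ℝ :=
    Matrix.fromBlocks 0 0 0 (realSymplecticForm N) with hω
  set G : Matrix ((Fin 2 × Fin M) ⊕ (Fin 2 × Fin N)) ((Fin 2 × Fin M) ⊕ (Fin 2 × Fin N)) ℂ :=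
    (cvCovarianceMatrix ρ).map Complex.ofReal -
      Matrix.fromBlocks 0 0 0 (Complex.I • symplecticForm N) with hG
  have hentry : ∀ j k, G j k =
      (cvCovarianceMatrix ρ j k : ℂ) - Complex.I * (ω j k : ℂ) := by
    rintro (j | j) (k | k) <;> simp [hω, hG, symplecticForm_eq_map]
  have hωswap : ∀ j k, ω k j = -ω j k := by
    rintro (j | j) (k | k) <;> simp [hω, realSymplecticForm_swap j]
  have hωsum : ∀ v w : (Fin 2 × Fin M) ⊕ (Fin 2 × Fin N) → ℝ, ∑ j, ∑ k, v j * ω j k * w k =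
      weylForm (fun j => v (.inr j)) (fun j => w (.inr j)) / 2 := fun v w => by
    rw [← sum_realSymplecticForm]
    simp [Fintype.sum_sum_type, hω]
  have hherm : G.IsHermitian := by
    ext j k
    rw [Matrix.conjTranspose_apply, hentry, hentry, cvCovarianceMatrix_symm k j, hωswap j k,
      Complex.star_def]
    simp [sub_eq_add_neg]
  change G.PosSemidef
  refine Matrix.PosSemidef.of_dotProduct_mulVec_nonneg hherm fun x => ?_
  refine Complex.nonneg_iff.2 ⟨?_, (hherm.im_star_dotProduct_mulVec_self x).symm⟩
  have hterm : ∀ j k, (star (x j) * ((cvCovarianceMatrix ρ j k : ℂ) - Complex.I * (ω j k : ℂ)) *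
      x k).re = (x j).re * cvCovarianceMatrix ρ j k * (x k).re +
        (x j).im * cvCovarianceMatrix ρ j k * (x k).im +
        ((x j).re * ω j k * (x k).im - (x j).im * ω j k * (x k).re) := fun j k => by
    simp [Complex.mul_re, Complex.mul_im]
    ring
  have hx : (star x ⬝ᵥ (G.mulVec x)).re =
      ∑ j, ∑ k, (star (x j) * ((cvCovarianceMatrix ρ j k : ℂ) - Complex.I * (ω j k : ℂ)) *
        x k).re := by
    rw [dotProduct, Complex.re_sum]
    refine Finset.sum_congr rfl fun j _ => ?_
    rw [Matrix.mulVec, dotProduct, Finset.mul_sum, Complex.re_sum]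
    refine Finset.sum_congr rfl fun k _ => ?_
    rw [hentry, Pi.star_apply, mul_assoc]
  rw [hx]
  simp only [hterm, Finset.sum_add_distrib, Finset.sum_sub_distrib]
  rw [hωsum (fun j => (x j).re) (fun j => (x j).im), hωsum (fun j => (x j).im) (fun j => (x j).re)]
  -- The imaginary part takes the role of `v`: then `-ω(q_B, p_B) = ω(p_B, q_B)` has the required
  -- sign.
  have h1 := h (fun j => (x j).im) (fun j => (x j).re)
  have h2 := weylForm_swap (fun j => (x (.inr j)).re) (fun j => (x (.inr j)).im)
  linarith

end Covariance
end CVSteering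

end

theorem proposition3 (M N : ℕ)
    (ρ : CVSteering.DensityOperator (CVSteering.BipartiteSpace M N))
    (hρ : ∀ j, CVSteering.FiniteSecondMoment ρ (CVSteering.localQuadrature M N j)) :
    (CVSteering.NonsteerableAtoB ρ → CVSteering.SatisfiesCVC ρ) ∧
      (¬ CVSteering.SatisfiesCVC ρ → CVSteering.SteerableAtoB ρ) := by
  have h : CVSteering.NonsteerableAtoB ρ → CVSteering.SatisfiesCVC ρ := fun h =>
    CVSteering.satisfiesCVC_of_quadratic (h.quadratic_form_nonneg hρ)
  exact ⟨h, fun hn hs => hn (h hs)⟩
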